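/- Let $B\subset\mathbb{C}^n$ be open and let $\varphi:B\to[-\infty,\infty)$ be quasi-plurisubharmonic, i.e. locally the sum of a plurisubharmonic function and a smooth real function. For open $U\subset B$ let $\mathcal I(\varphi)(U)$ be the set of holomorphic functions $g$ on $U$ such that $|g|e^{-\varphi}$ is locally square integrable on $U$ with respect to Lebesgue measure; this defines the multiplier ideal sheaf $\mathcal I(\varphi)\subset\mathcal O_B$. Let $G_1,\dots,G_N$ be holomorphic functions on $B$ whose germs generate the stalk $\mathcal I(\varphi)_p$ as an $\mathcal O_{B,p}$-module at every point $p\in B$. Let $(f_k)_{k\ge 1}$ be a sequence in $\mathcal I(\varphi)(B)$ converging to a function $f$ uniformly on every relatively compact subset $K\Subset B$. Then $f\in\mathcal I(\varphi)(B)$ (in particular $f$ is holomorphic on $B$), and for every relatively compact subset $K\Subset B$, $$\int_K |f_k-f|^2e^{-2\varphi}\longrightarrow 0\qquad (k\to\infty).$$ Here $K\Subset B$ means that the closure of $K$ in $\mathbb{C}^n$ is compact and contained in $B$. -/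

import Mathlib

open Set Filter Topology MeasureTheory
open scoped ENNReal ContDiff

noncomputable section

/-- `K ⋐ B`: the closure of `K` is compact and contained in `B`. -/
def RelCompactIn {X : Type*} [TopologicalSpace X] (K B : Set X) : Prop :=
  IsCompact (closure K) ∧ closure K ⊆ B

/-- The integral `∫ g⁺ dμ - ∫ g⁻ dμ` of an extended-real function. It is used only where
`∫ g⁺ dμ` is finite; its value may be `-∞`. -/
def extIntegral {α : Type*} [MeasurableSpace α] (μ : Measure α) (g : α → EReal) : EReal :=
  ((∫⁻ x, (g x).toENNReal ∂μ : ℝ≥0∞) : EReal) - ((∫⁻ x, (-g x).toENNReal ∂μ : ℝ≥0∞) : EReal)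

/-- The uniform probability measure `dθ / 2π` on `(0, 2π]`. -/
def angleMeasure : Measure ℝ :=
  ENNReal.ofReal (2 * Real.pi)⁻¹ • volume.restrict (Ioc 0 (2 * Real.pi))

/-- `φ : U → [-∞, ∞)` is plurisubharmonic on the open set `U ⊆ ℂⁿ`: it is upper semicontinuous
and satisfies the sub-mean value inequality on every closed complex disc contained in `U`. -/
structure IsPsh {n : ℕ} (φ : (Fin n → ℂ) → EReal) (U : Set (Fin n → ℂ)) : Prop where
  lt_top : ∀ x ∈ U, φ x < ⊤
  usc : UpperSemicontinuousOn φ U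
  le_mean : ∀ a w : Fin n → ℂ, (∀ ζ : ℂ, ‖ζ‖ ≤ 1 → a + ζ • w ∈ U) →
    φ a ≤ extIntegral angleMeasure (fun θ => φ (a + circleMap 0 1 θ • w))

/-- `φ` is quasi-plurisubharmonic on `B`: locally it is the sum of a plurisubharmonic function
and a smooth real function. -/
def IsQuasiPsh {n : ℕ} (φ : (Fin n → ℂ) → EReal) (B : Set (Fin n → ℂ)) : Prop :=
  ∀ p ∈ B, ∃ U : Set (Fin n → ℂ), IsOpen U ∧ p ∈ U ∧ U ⊆ B ∧
    ∃ (ψ : (Fin n → ℂ) → EReal) (ρ : (Fin n → ℂ) → ℝ),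
      IsPsh ψ U ∧ ContDiffOn ℝ ∞ ρ U ∧ ∀ x ∈ U, φ x = ψ x + (ρ x : EReal)

/-- `∫_K |f|² e^{-2φ}` with respect to Lebesgue measure on `ℂⁿ`, a value in `[0, ∞]`
(with `e^{-2φ} = ∞` where `φ = -∞`). -/
def weightedSqIntegral {n : ℕ} (φ : (Fin n → ℂ) → EReal) (f : (Fin n → ℂ) → ℂ)
    (K : Set (Fin n → ℂ)) : ℝ≥0∞ :=
  ∫⁻ x in K, ‖f x‖ₑ ^ 2 * EReal.exp (-2 * φ x)

/-- `f` is a section over the open set `U` of the multiplier ideal sheaf `I(φ)`: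
it is holomorphic on `U`, and `|f| e^{-φ}` is locally square integrable on `U`. -/
def IsMultiplierSection {n : ℕ} (φ : (Fin n → ℂ) → EReal) (U : Set (Fin n → ℂ))
    (f : (Fin n → ℂ) → ℂ) : Prop :=
  DifferentiableOn ℂ f U ∧ ∀ K ⊆ U, IsCompact K → weightedSqIntegral φ f K < ⊤

/-- The ring `O_p` of germs at `p` of holomorphic functions, inside the ring of all germs at `p`
of complex-valued functions. -/
def holGerms {n : ℕ} (p : Fin n → ℂ) : Subring (Germ (𝓝 p) ℂ) where
  carrier := {g | ∃ f : (Fin n → ℂ) → ℂ, (∀ᶠ x in 𝓝 p, DifferentiableAt ℂ f x) ∧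
    (f : Germ (𝓝 p) ℂ) = g}
  mul_mem' := by
    rintro _ _ ⟨f, hf, rfl⟩ ⟨g, hg, rfl⟩
    refine ⟨f * g, ?_, rfl⟩
    filter_upwards [hf, hg] with x h1 h2 using h1.mul h2
  one_mem' := ⟨1, Eventually.of_forall fun x => differentiableAt_const (1 : ℂ), rfl⟩
  add_mem' := by
    rintro _ _ ⟨f, hf, rfl⟩ ⟨g, hg, rfl⟩
    refine ⟨f + g, ?_, rfl⟩
    filter_upwards [hf, hg] with x h1 h2 using h1.add h2
  zero_mem' := ⟨0, Eventually.of_forall fun x => differentiableAt_const (0 : ℂ), rfl⟩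
  neg_mem' := by
    rintro _ ⟨f, hf, rfl⟩
    refine ⟨-f, ?_, rfl⟩
    filter_upwards [hf] with x h1 using h1.neg

/-- The stalk `I(φ)_p`: the germs at `p` of sections of `I(φ)` over open neighbourhoods of `p`. -/
def multiplierStalk {n : ℕ} (φ : (Fin n → ℂ) → EReal) (p : Fin n → ℂ) : Set (Germ (𝓝 p) ℂ) :=
  {g | ∃ (U : Set (Fin n → ℂ)) (F : (Fin n → ℂ) → ℂ), IsOpen U ∧ p ∈ U ∧
    IsMultiplierSection φ U F ∧ (F : Germ (𝓝 p) ℂ) = g}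

/-- The germs at `p` of the functions `G i` generate the stalk `I(φ)_p` over `O_p`: the set of all
combinations of these germs with coefficients in `O_p` is exactly `I(φ)_p`. -/
def GeneratesStalk {n N : ℕ} (G : Fin N → (Fin n → ℂ) → ℂ) (φ : (Fin n → ℂ) → EReal)
    (p : Fin n → ℂ) : Prop :=
  (Submodule.span (holGerms p) (Set.range fun i => (G i : Germ (𝓝 p) ℂ)) :
    Set (Germ (𝓝 p) ℂ)) = multiplierStalk φ p

end

/-! ### Holomorphic functions on complex normed spaces. -/

section Holomorphic

open Metric

variable {E : Type*} [NormedAddCommGroup E] [NormedSpace ℂ E]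

/-! The theorem combines closedness of ideals of germs with a Baire category argument.

The generation hypothesis identifies each stalk of the multiplier ideal sheaf with a span, so each
stalk is an ideal of the ring of germs. By Cartan, such an ideal is closed under uniform convergence
on a ball (`holomorphicGerms.mem_of_tendstoUniformlyOn`). Indeed, modulo a power of the maximal
ideal, membership becomes a linear condition on finitely many coefficients that are controlled by
the sup-norm, and finite-dimensional subspaces are closed; Krull's intersection theorem then removes
the power. Krull needs the ring of germs to be Noetherian, which is Rückert's theorem, deduced from
Weierstrass division by induction on the dimension. Hence the limit has its germs in the stalks, so
it is a section.

For the weighted convergence, fix a small open U. The bounded sections over U form a closed subspace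
of the bounded continuous functions, hence a Banach space (`isClosed_boundedSections`). The weighted
L² norm over a compact subset of U is a finite seminorm on it, lower semicontinuous by Fatou, and
therefore continuous by Baire (`continuous_weightedSeminorm`). So uniform convergence forces
weighted L² convergence, and compactness globalises this. Quasi-plurisubharmonicity enters through
the local measurability of the weight. -/

theorem norm_fderiv_le_of_norm_le_ball {f : E → ℂ} {c : E} {R M : ℝ} (hR : 0 < R)
    (hd : DifferentiableOn ℂ f (ball c R)) (hM : ∀ x ∈ ball c R, ‖f x‖ ≤ M) :
    ‖fderiv ℂ f c‖ ≤ 2 * M / R := by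
  refine Complex.norm_fderiv_le_div_of_mapsTo_ball hd (fun x hx => ?_) hR
  rw [mem_closedBall, dist_eq_norm]
  have h1 := hM x hx
  have h2 := hM c (mem_ball_self hR)
  have h3 := norm_sub_le (f x) (f c)
  linarith

/-- Weierstrass: a uniform limit of holomorphic functions is holomorphic. -/
theorem DifferentiableOn.of_tendstoUniformlyOn {f : ℕ → E → ℂ} {g : E → ℂ} {s : Set E}
    (hs : IsOpen s) (hf : ∀ k, DifferentiableOn ℂ (f k) s)
    (hg : TendstoUniformlyOn f g atTop s) : DifferentiableOn ℂ g s := by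
  intro x hx
  obtain ⟨ε, hε, hεs⟩ := Metric.isOpen_iff.1 hs x hx
  have hsub : ∀ y ∈ ball x (ε / 2), ball y (ε / 2) ⊆ s := fun y hy =>
    (ball_subset_ball' (by rw [mem_ball] at hy; linarith)).trans hεs
  have hfat : ∀ k, ∀ y ∈ s, DifferentiableAt ℂ (f k) y := fun k y hy =>
    (hf k).differentiableAt (hs.mem_nhds hy)
  have hys : ∀ y ∈ ball x (ε / 2), y ∈ s := fun y hy =>
    hsub y hy (mem_ball_self (by positivity))
  have hC : UniformCauchySeqOn (fun k => fderiv ℂ (f k)) atTop (ball x (ε / 2)) := by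
    rw [Metric.uniformCauchySeqOn_iff]
    intro δ hδ
    -- With sup bound `δ * ε / 8` and radius `ε / 2`, the Cauchy estimate gives `δ / 2`.
    obtain ⟨N, hN⟩ := Metric.uniformCauchySeqOn_iff.1 hg.uniformCauchySeqOn (δ * ε / 8)
      (by positivity)
    refine ⟨N, fun m hm k hk y hy => ?_⟩
    rw [dist_eq_norm, ← fderiv_fun_sub (hfat m y (hys y hy)) (hfat k y (hys y hy))]
    refine (norm_fderiv_le_of_norm_le_ball (M := δ * ε / 8) (half_pos hε)
      (((hf m).sub (hf k)).mono (hsub y hy)) fun z hz => ?_).trans_lt ?_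
    · have := hN m hm k hk z (hsub y hy hz)
      rw [dist_eq_norm] at this
      exact this.le
    · field_simp
      linarith
  have hlim : ∀ y, ∃ L, y ∈ ball x (ε / 2) →
      Tendsto (fun k => fderiv ℂ (f k) y) atTop (𝓝 L) := by
    intro y
    by_cases hy : y ∈ ball x (ε / 2)
    · obtain ⟨L, hL⟩ := cauchySeq_tendsto_of_complete (hC.cauchySeq hy)
      exact ⟨L, fun _ => hL⟩
    · exact ⟨0, fun h => absurd h hy⟩
  choose L hL using hlim
  have hU := hC.tendstoUniformlyOn_of_tendsto (f := L) fun y hy => hL y hy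
  exact (hasFDerivAt_of_tendstoUniformlyOn isOpen_ball hU
    (fun k y hy => (hfat k y (hys y hy)).hasFDerivAt)
    (fun y hy => hg.tendsto_at (hys y hy))
    (mem_ball_self (half_pos hε))).differentiableAt.differentiableWithinAt

/-- Two Cauchy estimates: local boundedness makes `f` Lipschitz, so the translate difference `v ↦ f
(z + v) - f (y + v)` is small with `z - y`, and so is its derivative at 0. The space may be
infinite-dimensional. The continuity supplies the measurability needed to differentiate under an
integral. -/
theorem DifferentiableOn.continuousOn_fderiv_complex {f : E → ℂ} {s : Set E}
    (hf : DifferentiableOn ℂ f s) (hs : IsOpen s) : ContinuousOn (fderiv ℂ f) s := by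
  intro y hy
  refine ContinuousAt.continuousWithinAt ?_
  have hev : ∀ᶠ z in 𝓝 y, z ∈ s ∧ ‖f z‖ ≤ ‖f y‖ + 1 := by
    have hc := (hf.differentiableAt (hs.mem_nhds hy)).continuousAt.norm
    filter_upwards [hs.mem_nhds hy, hc.eventually_lt_const (lt_add_one _)] with z h1 h2
      using ⟨h1, h2.le⟩
  obtain ⟨R, hR, hball⟩ := Metric.eventually_nhds_iff_ball.1 hev
  set M := ‖f y‖ + 1
  have hM : 0 ≤ M := by positivity
  set ρ := R / 3 with hρ
  have hρ0 : 0 < ρ := by positivity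
  have hsub : ∀ z ∈ ball y (2 * ρ), ball z ρ ⊆ ball y R := fun z hz =>
    ball_subset_ball' (by rw [mem_ball] at hz; linarith)
  have hd : ∀ z ∈ ball y R, DifferentiableAt ℂ f z := fun z hz =>
    hf.differentiableAt (hs.mem_nhds (hball z hz).1)
  have hLip : ∀ a ∈ ball y (2 * ρ), ∀ b ∈ ball y (2 * ρ), ‖f b - f a‖ ≤ 2 * M / ρ * ‖b - a‖ :=
    fun a ha b hb => (convex_ball y (2 * ρ)).norm_image_sub_le_of_norm_fderiv_le
      (𝕜 := ℂ) (fun z hz => hd z (hsub z hz (mem_ball_self hρ0)))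
      (fun z hz => norm_fderiv_le_of_norm_le_ball hρ0
        (fun w hw => (hd w (hsub z hz hw)).differentiableWithinAt)
        fun w hw => (hball w (hsub z hz hw)).2) ha hb
  have key : ∀ z ∈ ball y ρ, ‖fderiv ℂ f z - fderiv ℂ f y‖ ≤
      2 * (2 * M / ρ * ‖z - y‖) / ρ := by
    intro z hz
    have hmem : ∀ v ∈ ball (0 : E) ρ, ∀ w ∈ ball y ρ, w + v ∈ ball y (2 * ρ) := by
      intro v hv w hw
      rw [mem_ball, dist_eq_norm] at *
      calc ‖w + v - y‖ = ‖(w - y) + (v - 0)‖ := by congr 1; abel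
        _ ≤ ‖w - y‖ + ‖v - 0‖ := norm_add_le _ _
        _ < 2 * ρ := by linarith
    have hyy : y ∈ ball y ρ := mem_ball_self hρ0
    have hdv : ∀ v ∈ ball (0 : E) ρ, ∀ w ∈ ball y ρ,
        DifferentiableAt ℂ (fun v => f (w + v)) v := by
      intro v hv w hw
      have h1 := hd (w + v) (ball_subset_ball (by linarith) (hmem v hv w hw))
      exact h1.comp v ((differentiableAt_const w).add differentiableAt_id)
    have h0 := mem_ball_self (x := (0 : E)) hρ0
    have h1 := norm_fderiv_le_of_norm_le_ball (f := fun v => f (z + v) - f (y + v)) (c := 0)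
      (M := 2 * M / ρ * ‖z - y‖) hρ0
      (fun v hv => ((hdv v hv z hz).sub (hdv v hv y hyy)).differentiableWithinAt)
      (fun v hv => by
        have := hLip _ (hmem v hv y hyy) _ (hmem v hv z hz)
        simpa using this)
    rwa [fderiv_fun_sub (hdv 0 h0 z hz) (hdv 0 h0 y hyy), fderiv_comp_add_left,
      fderiv_comp_add_left, add_zero, add_zero] at h1
  rw [ContinuousAt, tendsto_iff_norm_sub_tendsto_zero]
  refine squeeze_zero' (Eventually.of_forall fun _ => norm_nonneg _)
    (Filter.mem_of_superset (ball_mem_nhds y hρ0) key) ?_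
  have : Tendsto (fun z => 2 * (2 * M / ρ * ‖z - y‖) / ρ) (𝓝 y)
      (𝓝 (2 * (2 * M / ρ * ‖y - y‖) / ρ)) := by
    apply Continuous.tendsto
    fun_prop
  simpa using this

/-- The compact path has a thickening inside `s`, where Cauchy estimates dominate the derivative of
the integrand by a constant. -/
theorem differentiableAt_integral_comp_add {k : E → ℂ} {s : Set E} (hs : IsOpen s)
    (hk : DifferentiableOn ℂ k s) {M : ℝ} (hM : ∀ x ∈ s, ‖k x‖ ≤ M) {γ : ℝ → E}
    (hγ : Continuous γ) {a b : ℝ} {x₀ : E} (hx₀ : ∀ θ ∈ uIcc a b, x₀ + γ θ ∈ s) :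
    DifferentiableAt ℂ (fun x => ∫ θ in a..b, k (x + γ θ)) x₀ := by
  have hK : IsCompact ((fun θ => x₀ + γ θ) '' uIcc a b) :=
    isCompact_uIcc.image (by fun_prop)
  obtain ⟨δ, hδ, hsub⟩ := hK.exists_thickening_subset_open hs (by rintro _ ⟨θ, hθ, rfl⟩; exact hx₀ θ hθ)
  have hball : ∀ x ∈ ball x₀ (δ / 2), ∀ θ ∈ uIcc a b, ball (x + γ θ) (δ / 2) ⊆ s := by
    intro x hx θ hθ y hy
    refine hsub (mem_thickening_iff.2 ⟨_, ⟨θ, hθ, rfl⟩, ?_⟩)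
    rw [mem_ball] at hx hy
    calc dist y (x₀ + γ θ) ≤ dist y (x + γ θ) + dist (x + γ θ) (x₀ + γ θ) := dist_triangle _ _ _
      _ < δ := by rw [dist_add_right]; linarith
  have hmem : ∀ x ∈ ball x₀ (δ / 2), ∀ θ ∈ uIcc a b, x + γ θ ∈ s := fun x hx θ hθ =>
    hball x hx θ hθ (mem_ball_self (half_pos hδ))
  have hcont : ∀ x ∈ ball x₀ (δ / 2), ContinuousOn (fun θ => k (x + γ θ)) (uIcc a b) :=
    fun x hx => hk.continuousOn.comp (by fun_prop) fun θ hθ => hmem x hx θ hθ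
  have hx₀' := mem_ball_self (x := x₀) (half_pos hδ)
  refine (intervalIntegral.hasFDerivAt_integral_of_dominated_of_fderiv_le (𝕜 := ℂ)
    (F' := fun x θ => fderiv ℂ k (x + γ θ)) (bound := fun _ => 2 * M / (δ / 2))
    (ball_mem_nhds x₀ (half_pos hδ)) ?_ (hcont x₀ hx₀').intervalIntegrable ?_ ?_
    intervalIntegrable_const ?_).differentiableAt
  · filter_upwards [ball_mem_nhds x₀ (half_pos hδ)] with x hx
    exact ((hcont x hx).mono uIoc_subset_uIcc).aestronglyMeasurable measurableSet_uIoc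
  · refine ContinuousOn.aestronglyMeasurable ?_ measurableSet_uIoc
    exact (hk.continuousOn_fderiv_complex hs).comp (by fun_prop)
      fun θ hθ => hmem x₀ hx₀' θ (uIoc_subset_uIcc hθ)
  · refine Eventually.of_forall fun θ hθ x hx => ?_
    have hB := hball x hx θ (uIoc_subset_uIcc hθ)
    exact norm_fderiv_le_of_norm_le_ball (half_pos hδ) (hk.mono hB) fun y hy => hM y (hB hy)
  · refine Eventually.of_forall fun θ hθ x hx => ?_
    have := (hk.differentiableAt (hs.mem_nhds (hmem x hx θ (uIoc_subset_uIcc hθ)))).hasFDerivAt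
    exact HasFDerivAt.comp x (f := fun x => x + γ θ) this ((hasFDerivAt_id x).add_const (γ θ))

/-- Division by a linear coordinate `ℓ` with a sup-norm bound. -/
theorem exists_eq_add_coord_mul (ℓ : E →L[ℂ] ℂ) (e : E) (he : ℓ e = 1) {D : Set E}
    (hD : IsOpen D) {r : ℝ} (hr : 0 < r) (hDr : ∀ x ∈ D, ‖ℓ x‖ < r)
    (hDe : ∀ x ∈ D, ∀ t : ℂ, ‖t‖ < r → x + (t - ℓ x) • e ∈ D) {h : E → ℂ}
    (hh : DifferentiableOn ℂ h D) {M : ℝ} (hM : ∀ x ∈ D, ‖h x‖ ≤ M) :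
    ∃ h₁ : E → ℂ, DifferentiableOn ℂ h₁ D ∧ (∀ x ∈ D, ‖h₁ x‖ ≤ 2 * M / r) ∧
      ∀ x ∈ D, h x = h (x - ℓ x • e) + ℓ x * h₁ x := by
  set φ : E → ℂ → ℂ := fun x t => h (x + (t - ℓ x) • e) with hφ
  have hφd : ∀ x ∈ D, DifferentiableOn ℂ (φ x) (ball 0 r) := fun x hx =>
    hh.comp (by fun_prop) fun t ht => hDe x hx t (by simpa using ht)
  have hφ0 : ∀ x, φ x 0 = h (x - ℓ x • e) := fun x => by
    simp only [hφ]; congr 1; module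
  have hφℓ : ∀ x, φ x (ℓ x) = h x := fun x => by simp [hφ]
  have hφe : ∀ x (c : ℂ), φ (x + c • e) = φ x := fun x c => by
    ext t; simp only [hφ, map_add, map_smul, he, smul_eq_mul, mul_one]; congr 1; module
  -- Difference quotient along the complex line through `x` in direction `e`; `dslope` supplies the
  -- derivative where `ℓ x = 0`.
  set h₁ : E → ℂ := fun x => dslope (φ x) 0 (ℓ x) with hh₁
  have hb : ∀ x ∈ D, ‖h₁ x‖ ≤ 2 * M / r := by
    intro x hx
    refine Complex.norm_dslope_le_div_of_mapsTo_ball (hφd x hx) (fun t ht => ?_)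
      (by simpa using hDr x hx)
    rw [mem_closedBall, dist_eq_norm]
    have h1 := hM _ (hDe x hx t (by simpa using ht))
    have h2 := hM _ (hDe x hx 0 (by simpa using hr))
    have h3 := norm_sub_le (φ x t) (φ x 0)
    simp only [hφ] at h3 ⊢
    linarith
  have hne : ∀ x, ℓ x ≠ 0 → h₁ x = (h x - h (x - ℓ x • e)) / ℓ x := by
    intro x hx
    simp only [hh₁]
    rw [dslope_of_ne _ hx, slope_def_field, hφℓ, hφ0, sub_zero]
  have hπ : ∀ x ∈ D, x - ℓ x • e ∈ D := fun x hx => by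
    have := hDe x hx 0 (by simpa using hr)
    convert this using 1
    module
  have hdne : ∀ x ∈ D, ℓ x ≠ 0 → DifferentiableAt ℂ h₁ x := by
    intro x hx hx0
    have hev : h₁ =ᶠ[𝓝 x] fun y => (h y - h (y - ℓ y • e)) / ℓ y := by
      filter_upwards [(ℓ.continuous.continuousAt (x := x)).eventually_ne hx0] with y hy using hne y hy
    refine DifferentiableAt.congr_of_eventuallyEq ?_ hev
    have h1 := hh.differentiableAt (hD.mem_nhds hx)
    have h2 : DifferentiableAt ℂ (fun y => h (y - ℓ y • e)) x :=
      DifferentiableAt.comp (f := fun y => y - ℓ y • e) x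
        (hh.differentiableAt (hD.mem_nhds (hπ x hx))) (by fun_prop)
    simp only [div_eq_mul_inv]
    exact (h1.sub h2).mul (ℓ.differentiableAt.inv hx0)
  refine ⟨h₁, fun x hx => DifferentiableAt.differentiableWithinAt ?_, hb, fun x hx => ?_⟩
  · by_cases hx0 : ℓ x = 0
    · have hr2 : 0 < r / 2 := by positivity
      set s : Set E := D ∩ {y | ℓ y ≠ 0} with hs
      have hso : IsOpen s := hD.inter (isOpen_ne_fun ℓ.continuous continuous_const)
      -- Where `ℓ x = 0`, the mean value property represents `h₁` near `x` as its own average over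
      -- circles of radius `r / 2` in direction `e`. The circle about `x` avoids `ℓ = 0`, so there
      -- `h₁` is an ordinary holomorphic quotient.
      have hint := differentiableAt_integral_comp_add (k := h₁) hso
        (fun y hy => (hdne y hy.1 hy.2).differentiableWithinAt) (fun y hy => hb y hy.1)
        (γ := fun θ => circleMap 0 (r / 2) θ • e) (a := 0) (b := 2 * Real.pi) (x₀ := x)
        (by fun_prop) (by
          intro θ _
          have hn : ‖circleMap 0 (r / 2) θ‖ = r / 2 := by
            rw [norm_circleMap_zero, abs_of_pos hr2]
          refine ⟨?_, ?_⟩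
          · have := hDe x hx (circleMap 0 (r / 2) θ) (by rw [hn]; linarith)
            simpa [hx0] using this
          · have : circleMap 0 (r / 2) θ ≠ 0 := by
              rw [← norm_pos_iff, hn]; exact hr2
            simpa [hx0, he] using this)
      refine (hint.const_smul (2 * Real.pi)⁻¹).congr_of_eventuallyEq ?_
      have hsmall : ∀ᶠ y in 𝓝 x, ‖ℓ y‖ < r / 2 := by
        refine (ℓ.continuous.norm.continuousAt (x := x)).eventually_lt continuousAt_const ?_
        simpa [hx0] using hr2
      filter_upwards [hsmall, hD.mem_nhds hx] with y hy hyD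
      have hdc : DiffContOnCl ℂ (dslope (φ y) 0) (ball (ℓ y) |r / 2|) := by
        rw [abs_of_pos hr2]
        refine DifferentiableOn.diffContOnCl_ball (U := ball 0 r)
          ((Complex.differentiableOn_dslope (ball_mem_nhds 0 hr)).2 (hφd y hyD)) ?_
        refine closedBall_subset_ball' ?_
        rw [dist_zero_right]; linarith
      have hav := hdc.circleAverage
      rw [Real.circleAverage_def] at hav
      change dslope (φ y) 0 (ℓ y) = _
      rw [← hav]
      change _ = (2 * Real.pi)⁻¹ • ∫ θ in (0:ℝ)..2 * Real.pi, h₁ (y + circleMap 0 (r / 2) θ • e)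
      congr 1
      refine intervalIntegral.integral_congr fun θ _ => ?_
      simp only [hh₁, hφe, map_add, map_smul, he, smul_eq_mul, mul_one]
      congr 1
      simp [circleMap]
    · exact hdne x hx hx0
  · by_cases hx0 : ℓ x = 0
    · simp [hx0]
    · rw [hne x hx0]; field_simp; ring

end Holomorphic

/-! ### Weierstrass division. -/

section WeierstrassDivision

open Metric

variable {E : Type*} [NormedAddCommGroup E] [NormedSpace ℂ E]

theorem exists_ball_differentiableOn_norm_le {f : E → ℂ} {p : E}
    (hf : ∀ᶠ x in 𝓝 p, DifferentiableAt ℂ f x) :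
    ∃ R > 0, DifferentiableOn ℂ f (ball p R) ∧ ∃ M ≥ 0, ∀ x ∈ ball p R, ‖f x‖ ≤ M := by
  have hc := hf.self_of_nhds.continuousAt.norm
  obtain ⟨R, hR, hball⟩ := Metric.eventually_nhds_iff_ball.1
    (hf.and (hc.eventually_lt_const (lt_add_one _)))
  exact ⟨R, hR, fun x hx => (hball x hx).1.differentiableWithinAt, ‖f p‖ + 1, by positivity,
    fun x hx => (hball x hx).2.le⟩

/-- The iterated difference quotients in the last variable, with sup-norm bounds. -/
theorem exists_iterated_slopes {ρ r M : ℝ} (hr : 0 < r) {h : E × ℂ → ℂ}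
    (hh : DifferentiableOn ℂ h (ball 0 ρ ×ˢ ball 0 r))
    (hM : ∀ x ∈ ball (0 : E) ρ ×ˢ ball (0 : ℂ) r, ‖h x‖ ≤ M) :
    ∃ A : ℕ → E × ℂ → ℂ, A 0 = h ∧ ∀ k, DifferentiableOn ℂ (A k) (ball 0 ρ ×ˢ ball 0 r) ∧
      (∀ x ∈ ball (0 : E) ρ ×ˢ ball (0 : ℂ) r, ‖A k x‖ ≤ (2 / r) ^ k * M) ∧
      ∀ x ∈ ball (0 : E) ρ ×ˢ ball (0 : ℂ) r, A k x = A k (x.1, 0) + x.2 * A (k + 1) x := by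
  set D : Set (E × ℂ) := ball 0 ρ ×ˢ ball 0 r with hD
  have step : ∀ (k : ℕ) (f : E × ℂ → ℂ),
      (DifferentiableOn ℂ f D ∧ ∀ x ∈ D, ‖f x‖ ≤ (2 / r) ^ k * M) →
      ∃ f' : E × ℂ → ℂ, (DifferentiableOn ℂ f' D ∧ ∀ x ∈ D, ‖f' x‖ ≤ (2 / r) ^ (k + 1) * M) ∧
        ∀ x ∈ D, f x = f (x.1, 0) + x.2 * f' x := by
    rintro k f ⟨hf, hfM⟩
    obtain ⟨f', h1, h2, h3⟩ := exists_eq_add_coord_mul (ContinuousLinearMap.snd ℂ E ℂ) (0, 1)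
      (by simp) (isOpen_ball.prod isOpen_ball) hr (fun x hx => by simpa using hx.2)
      (fun x hx t ht => by
        refine ⟨?_, ?_⟩
        · simpa using hx.1
        · simpa using ht) hf hfM
    refine ⟨f', ⟨h1, fun x hx => (h2 x hx).trans_eq (by ring)⟩, fun x hx => ?_⟩
    rw [h3 x hx]
    congr 2
    ext <;> simp
  choose! F hF1 hF2 using step
  let A : ℕ → E × ℂ → ℂ := fun n => Nat.rec h (fun k f => F k f) n
  have hA : ∀ k, DifferentiableOn ℂ (A k) D ∧ ∀ x ∈ D, ‖A k x‖ ≤ (2 / r) ^ k * M := by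
    intro k
    induction k with
    | zero => exact ⟨hh, fun x hx => (hM x hx).trans_eq (by ring)⟩
    | succ k ih => exact hF1 k _ ih
  exact ⟨A, rfl, fun k => ⟨(hA k).1, (hA k).2, hF2 k _ (hA k)⟩⟩

theorem eq_sum_add_pow_mul_of_slopes {F : Type*} {D : Set (F × ℂ)} {A : ℕ → F × ℂ → ℂ}
    (hA : ∀ k, ∀ x ∈ D, A k x = A k (x.1, 0) + x.2 * A (k + 1) x) (d : ℕ) {x : F × ℂ}
    (hx : x ∈ D) :
    A 0 x = ∑ j ∈ Finset.range d, A j (x.1, 0) * x.2 ^ j + x.2 ^ d * A d x := by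
  induction d with
  | zero => simp
  | succ d ih =>
    rw [ih, Finset.sum_range_succ]
    conv_lhs => rw [hA d x hx]
    ring

theorem DifferentiableOn.slice_zero {ρ r : ℝ} (hr : 0 < r) {f : E × ℂ → ℂ}
    (hf : DifferentiableOn ℂ f (ball 0 ρ ×ˢ ball 0 r)) :
    DifferentiableOn ℂ (fun w => f (w, 0)) (ball 0 ρ) :=
  hf.comp (by fun_prop) fun w hw => ⟨hw, mem_ball_self hr⟩

/-- One step of the division by `g = s + z ^ d * u`, where `s` is small: the remainder has half
the norm of the dividend. -/
theorem exists_approximate_division {ρ r c : ℝ} (hρ : 0 < ρ) (hr : 0 < r) (hc : 0 < c) {d : ℕ}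
    {u : E × ℂ → ℂ} (hu : DifferentiableOn ℂ u (ball 0 ρ ×ˢ ball 0 r))
    (huc : ∀ x ∈ ball (0 : E) ρ ×ˢ ball (0 : ℂ) r, c ≤ ‖u x‖)
    {s : E × ℂ → ℂ} (hs : DifferentiableOn ℂ s (ball 0 ρ ×ˢ ball 0 r))
    (hsε : ∀ x ∈ ball (0 : E) ρ ×ˢ ball (0 : ℂ) r, (2 / r) ^ d / c * ‖s x‖ ≤ 1 / 2)
    {h : E × ℂ → ℂ} {M : ℝ} (hh : DifferentiableOn ℂ h (ball 0 ρ ×ˢ ball 0 r))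
    (hM : ∀ x ∈ ball (0 : E) ρ ×ˢ ball (0 : ℂ) r, ‖h x‖ ≤ M) :
    ∃ (q : E × ℂ → ℂ) (b : ℕ → E → ℂ) (h' : E × ℂ → ℂ),
      DifferentiableOn ℂ q (ball 0 ρ ×ˢ ball 0 r) ∧ (∀ j, DifferentiableOn ℂ (b j) (ball 0 ρ)) ∧
      DifferentiableOn ℂ h' (ball 0 ρ ×ˢ ball 0 r) ∧
      (∀ x ∈ ball (0 : E) ρ ×ˢ ball (0 : ℂ) r, ‖q x‖ ≤ (2 / r) ^ d / c * M) ∧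
      (∀ j, ∀ w ∈ ball (0 : E) ρ, ‖b j w‖ ≤ (2 / r) ^ j * M) ∧
      (∀ x ∈ ball (0 : E) ρ ×ˢ ball (0 : ℂ) r, ‖h' x‖ ≤ M / 2) ∧
      ∀ x ∈ ball (0 : E) ρ ×ˢ ball (0 : ℂ) r, h x = q x * (s x + x.2 ^ d * u x) +
        ∑ j ∈ Finset.range d, b j x.1 * x.2 ^ j + h' x := by
  set D : Set (E × ℂ) := ball 0 ρ ×ˢ ball 0 r with hD
  obtain ⟨A, rfl, hA⟩ := exists_iterated_slopes hr hh hM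
  have h0D : ((0 : E), (0 : ℂ)) ∈ D := ⟨mem_ball_self hρ, mem_ball_self hr⟩
  have hM0 : 0 ≤ M := (norm_nonneg _).trans (hM _ h0D)
  have hu0 : ∀ x ∈ D, u x ≠ 0 := fun x hx => norm_pos_iff.1 (hc.trans_le (huc x hx))
  have hq : DifferentiableOn ℂ (fun x => A d x * (u x)⁻¹) D := (hA d).1.mul (hu.inv hu0)
  have hqb : ∀ x ∈ D, ‖A d x * (u x)⁻¹‖ ≤ (2 / r) ^ d / c * M := by
    intro x hx
    rw [norm_mul, norm_inv]
    calc ‖A d x‖ * ‖u x‖⁻¹ ≤ ((2 / r) ^ d * M) * c⁻¹ :=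
          mul_le_mul ((hA d).2.1 x hx) (inv_anti₀ hc (huc x hx)) (by positivity) (by positivity)
      _ = _ := by ring
  -- Since `h` is its Taylor polynomial of degree below `d` in the last variable plus `z ^ d * A d`,
  -- the quotient `q = A d / u` cancels the tail and leaves the error `-q * s`.
  refine ⟨fun x => A d x * (u x)⁻¹, fun j w => A j (w, 0), fun x => -(A d x * (u x)⁻¹ * s x),
    hq, fun j => (hA j).1.slice_zero hr, (hq.mul hs).neg, hqb,
    fun j w hw => (hA j).2.1 _ ⟨hw, mem_ball_self hr⟩, fun x hx => ?_, fun x hx => ?_⟩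
  · rw [norm_neg, norm_mul]
    calc ‖A d x * (u x)⁻¹‖ * ‖s x‖ ≤ (2 / r) ^ d / c * M * ‖s x‖ := by
          gcongr; exact hqb x hx
      _ = (2 / r) ^ d / c * ‖s x‖ * M := by ring
      _ ≤ 1 / 2 * M := by gcongr; exact hsε x hx
      _ = M / 2 := by ring
  · rw [eq_sum_add_pow_mul_of_slopes (fun k => (hA k).2.2) d hx]
    have := hu0 x hx
    field_simp
    ring

theorem DifferentiableOn.tsum_of_norm_le {s : Set E} (hs : IsOpen s) {f : ℕ → E → ℂ}
    {v : ℕ → ℝ} (hv : Summable v) (hf : ∀ k, DifferentiableOn ℂ (f k) s)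
    (hfv : ∀ k, ∀ x ∈ s, ‖f k x‖ ≤ v k) : DifferentiableOn ℂ (fun x => ∑' k, f k x) s :=
  DifferentiableOn.of_tendstoUniformlyOn hs
    (fun _ => DifferentiableOn.fun_sum fun k _ => hf k)
    (tendstoUniformlyOn_tsum_nat hv hfv)

/-- Iterating the approximate division halves the remainder each time, so the quotients and
coefficients sum as geometrically dominated series. -/
theorem exists_division_of_small {ρ r c : ℝ} (hρ : 0 < ρ) (hr : 0 < r) (hc : 0 < c) {d : ℕ}
    {u : E × ℂ → ℂ} (hu : DifferentiableOn ℂ u (ball 0 ρ ×ˢ ball 0 r))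
    (huc : ∀ x ∈ ball (0 : E) ρ ×ˢ ball (0 : ℂ) r, c ≤ ‖u x‖)
    {s : E × ℂ → ℂ} (hs : DifferentiableOn ℂ s (ball 0 ρ ×ˢ ball 0 r))
    (hsε : ∀ x ∈ ball (0 : E) ρ ×ˢ ball (0 : ℂ) r, (2 / r) ^ d / c * ‖s x‖ ≤ 1 / 2)
    {h : E × ℂ → ℂ} {M : ℝ} (hh : DifferentiableOn ℂ h (ball 0 ρ ×ˢ ball 0 r))
    (hM : ∀ x ∈ ball (0 : E) ρ ×ˢ ball (0 : ℂ) r, ‖h x‖ ≤ M) :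
    ∃ (q : E × ℂ → ℂ) (b : ℕ → E → ℂ),
      DifferentiableOn ℂ q (ball 0 ρ ×ˢ ball 0 r) ∧ (∀ j, DifferentiableOn ℂ (b j) (ball 0 ρ)) ∧
      ∀ x ∈ ball (0 : E) ρ ×ˢ ball (0 : ℂ) r, h x = q x * (s x + x.2 ^ d * u x) +
        ∑ j ∈ Finset.range d, b j x.1 * x.2 ^ j := by
  set D : Set (E × ℂ) := ball 0 ρ ×ˢ ball 0 r with hD
  have step : ∀ (k : ℕ) (f : E × ℂ → ℂ),
      (DifferentiableOn ℂ f D ∧ ∀ x ∈ D, ‖f x‖ ≤ M * (1 / 2) ^ k) → _ :=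
    fun k f hf => exists_approximate_division hρ hr hc hu huc hs hsε hf.1 hf.2
  choose! q b h' hq hb hh' hqM hbM hhM heq using step
  let H : ℕ → E × ℂ → ℂ := fun n => Nat.rec h (fun k f => h' k f) n
  have hH : ∀ k, DifferentiableOn ℂ (H k) D ∧ ∀ x ∈ D, ‖H k x‖ ≤ M * (1 / 2) ^ k := by
    intro k
    induction k with
    | zero => exact ⟨hh, fun x hx => (hM x hx).trans_eq (by ring)⟩
    | succ k ih => exact ⟨hh' k _ ih, fun x hx => (hhM k _ ih x hx).trans_eq (by ring)⟩
  have hgeo : Summable fun k : ℕ => M * (1 / 2 : ℝ) ^ k :=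
    (summable_geometric_of_lt_one (by norm_num) (by norm_num)).mul_left M
  have hQs := hgeo.mul_left ((2 / r) ^ d / c)
  have hBs := fun j : ℕ => hgeo.mul_left ((2 / r) ^ j)
  refine ⟨fun x => ∑' k, q k (H k) x, fun j w => ∑' k, b k (H k) j w,
    DifferentiableOn.tsum_of_norm_le (isOpen_ball.prod isOpen_ball) hQs
      (fun k => hq k _ (hH k)) fun k => hqM k _ (hH k),
    fun j => DifferentiableOn.tsum_of_norm_le isOpen_ball (hBs j)
      (fun k => hb k _ (hH k) j) fun k => hbM k _ (hH k) j, fun x hx => ?_⟩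
  have hpart : ∀ n, h x = (∑ k ∈ Finset.range n, q k (H k) x) * (s x + x.2 ^ d * u x) +
      ∑ j ∈ Finset.range d, (∑ k ∈ Finset.range n, b k (H k) j x.1) * x.2 ^ j + H n x := by
    intro n
    induction n with
    | zero => simp [H]
    | succ n ih =>
      rw [ih, heq n _ (hH n) x hx]
      simp only [Finset.sum_range_succ, add_mul, Finset.sum_add_distrib]
      change _ = _ + h' n (H n) x
      ring
  have hq_lim : Tendsto (fun n => ∑ k ∈ Finset.range n, q k (H k) x) atTop
      (𝓝 (∑' k, q k (H k) x)) :=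
    (Summable.of_norm_bounded hQs fun k => hqM k _ (hH k) x hx).hasSum.tendsto_sum_nat
  have hb_lim : ∀ j, Tendsto (fun n => ∑ k ∈ Finset.range n, b k (H k) j x.1) atTop
      (𝓝 (∑' k, b k (H k) j x.1)) := fun j =>
    (Summable.of_norm_bounded (hBs j) fun k =>
      hbM k _ (hH k) j x.1 hx.1).hasSum.tendsto_sum_nat
  have hH_lim : Tendsto (fun n => H n x) atTop (𝓝 0) :=
    squeeze_zero_norm (fun n => (hH n).2 x hx) hgeo.tendsto_atTop_zero
  have hlim := ((hq_lim.mul_const (s x + x.2 ^ d * u x)).add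
    (tendsto_finsetSum (Finset.range d) fun j _ => (hb_lim j).mul_const (x.2 ^ j))).add hH_lim
  rw [add_zero] at hlim
  exact tendsto_nhds_unique (tendsto_const_nhds.congr hpart) hlim

/-- Weierstrass division for germs at the origin of `E × ℂ`. -/
theorem weierstrass_division {g : E × ℂ → ℂ} (hg : ∀ᶠ x in 𝓝 0, DifferentiableAt ℂ g x)
    (hg0 : ∃ᶠ z in 𝓝 (0 : ℂ), g (0, z) ≠ 0) :
    ∃ d : ℕ, ∀ f : E × ℂ → ℂ, (∀ᶠ x in 𝓝 0, DifferentiableAt ℂ f x) →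
      ∃ (q : E × ℂ → ℂ) (b : ℕ → E → ℂ), (∀ᶠ x in 𝓝 0, DifferentiableAt ℂ q x) ∧
        (∀ j, ∀ᶠ w in 𝓝 0, DifferentiableAt ℂ (b j) w) ∧
        ∀ᶠ x in 𝓝 0, f x = q x * g x + ∑ j ∈ Finset.range d, b j x.1 * x.2 ^ j := by
  obtain ⟨R, hR, hgd, M, hM0, hM⟩ := exists_ball_differentiableOn_norm_le hg
  have hball : ∀ a : ℝ, ball (0 : E × ℂ) a = ball 0 a ×ˢ ball 0 a := fun a =>
    (ball_prod_same _ _ _).symm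
  rw [hball] at hgd hM
  obtain ⟨A, rfl, hA⟩ := exists_iterated_slopes hR hgd hM
  have h0 : ((0 : E), (0 : ℂ)) ∈ ball (0 : E) R ×ˢ ball (0 : ℂ) R :=
    ⟨mem_ball_self hR, mem_ball_self hR⟩
  -- If all Taylor coefficients of `z ↦ g (0, z)` vanished, then for `‖z‖ < R / 4` the tail bound
  -- `(R / 4 * (2 / R)) ^ d * M` would tend to 0 and `g (0, z)` would vanish near 0.
  have hex : ∃ d, A d (0, 0) ≠ 0 := by
    by_contra! hall
    refine hg0 ?_
    filter_upwards [ball_mem_nhds (0 : ℂ) (show 0 < R / 4 by positivity)] with z hz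
    rw [not_not]
    have hz' : ‖z‖ < R / 4 := by simpa using hz
    have hmem : ((0 : E), z) ∈ ball (0 : E) R ×ˢ ball (0 : ℂ) R :=
      ⟨mem_ball_self hR, ball_subset_ball (by linarith) hz⟩
    have hle : ∀ d : ℕ, ‖A 0 (0, z)‖ ≤ M * (1 / 2) ^ d := by
      intro d
      rw [eq_sum_add_pow_mul_of_slopes (fun k => (hA k).2.2) d hmem]
      simp only [hall, zero_mul, Finset.sum_const_zero, zero_add, norm_mul, norm_pow]
      calc ‖z‖ ^ d * ‖A d (0, z)‖ ≤ (R / 4) ^ d * ((2 / R) ^ d * M) := by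
            gcongr
            exact (hA d).2.1 _ hmem
        _ = M * (R / 4 * (2 / R)) ^ d := by rw [mul_pow]; ring
        _ = M * (1 / 2) ^ d := by congr 2; field_simp; norm_num
    have hlim : Tendsto (fun d : ℕ => M * (1 / 2 : ℝ) ^ d) atTop (𝓝 (M * 0)) :=
      (tendsto_pow_atTop_nhds_zero_of_lt_one (by norm_num) (by norm_num)).const_mul M
    rw [mul_zero] at hlim
    exact norm_le_zero_iff.1 (ge_of_tendsto' hlim hle)
  classical
  -- The order of vanishing of `g (0, z)` at 0; it is fixed before the dividend `f` appears.
  set d := Nat.find hex with hd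
  have hd0 : A d (0, 0) ≠ 0 := Nat.find_spec hex
  have hdj : ∀ j < d, A j (0, 0) = 0 := fun j hj => not_not.1 (Nat.find_min hex hj)
  refine ⟨d, fun f hf => ?_⟩
  obtain ⟨R₁, hR₁, hfd, M₁, -, hM₁⟩ := exists_ball_differentiableOn_norm_le hf
  have hAc : ∀ k, ContinuousAt (A k) 0 := fun k =>
    (hA k).1.continuousOn.continuousAt ((isOpen_ball.prod isOpen_ball).mem_nhds h0)
  have hc : 0 < ‖A d (0, 0)‖ / 2 := by positivity
  set c := ‖A d (0, 0)‖ / 2 with hc_def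
  obtain ⟨R₂, hR₂, hu⟩ := Metric.eventually_nhds_iff_ball.1
    ((hAc d).norm.eventually_const_lt (show c < ‖A d 0‖ by
      change c < ‖A d (0, 0)‖; linarith))
  set r := min (min R R₁) (min R₂ 1) with hr_def
  have hr : 0 < r := by positivity
  have hrR : r ≤ R := (min_le_left _ _).trans (min_le_left _ _)
  have hrR₁ : r ≤ R₁ := (min_le_left _ _).trans (min_le_right _ _)
  have hrR₂ : r ≤ R₂ := (min_le_right _ _).trans (min_le_left _ _)
  have hr1 : r ≤ 1 := (min_le_right _ _).trans (min_le_right _ _)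
  have hσ : Tendsto (fun w : E => (2 / r) ^ d / c * ∑ j ∈ Finset.range d, ‖A j (w, 0)‖) (𝓝 0)
      (𝓝 ((2 / r) ^ d / c * ∑ j ∈ Finset.range d, ‖A j (0, 0)‖)) := by
    refine Tendsto.const_mul _ (tendsto_finsetSum _ fun j _ => ?_)
    have h1 : Tendsto (fun w : E => (w, (0 : ℂ))) (𝓝 0) (𝓝 (0, 0)) :=
      (Continuous.tendsto (by fun_prop) _)
    exact ((hAc j).tendsto.comp h1).norm
  rw [Finset.sum_eq_zero fun j hj => by rw [hdj j (Finset.mem_range.1 hj), norm_zero],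
    mul_zero] at hσ
  obtain ⟨R₃, hR₃, hs⟩ := Metric.eventually_nhds_iff_ball.1
    (hσ.eventually_lt_const (show (0 : ℝ) < 1 / 2 by norm_num))
  -- The radius in `E` comes after `r`: the required smallness of the low-order part `s` involves
  -- `(2 / r) ^ d / c`, and its coefficients vanish at `w = 0`.
  set ρ := min r R₃ with hρ_def
  have hρ : 0 < ρ := by positivity
  have hρr : ρ ≤ r := min_le_left _ _
  have hsub : ∀ a, r ≤ a → ball (0 : E) ρ ×ˢ ball (0 : ℂ) r ⊆ ball 0 a ×ˢ ball 0 a := fun a ha =>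
    prod_mono (ball_subset_ball (hρr.trans ha)) (ball_subset_ball ha)
  set s : E × ℂ → ℂ := fun x => ∑ j ∈ Finset.range d, A j (x.1, 0) * x.2 ^ j with hs_def
  have hsd : DifferentiableOn ℂ s (ball 0 ρ ×ˢ ball 0 r) := by
    refine DifferentiableOn.fun_sum fun j _ => ?_
    have h1 : DifferentiableOn ℂ (fun x : E × ℂ => A j (x.1, 0)) (ball 0 ρ ×ˢ ball 0 r) :=
      (hA j).1.comp (t := ball 0 R ×ˢ ball 0 R) (by fun_prop)
        fun x hx => ⟨(hsub R hrR hx).1, mem_ball_self hR⟩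
    exact h1.mul (by fun_prop)
  obtain ⟨q, b, hq, hb, heq⟩ := exists_division_of_small hρ hr hc (d := d)
    ((hA d).1.mono (hsub R hrR))
    (fun x hx => (hu x (by rw [hball]; exact hsub R₂ hrR₂ hx)).le) hsd (fun x hx => by
      refine le_trans ?_ (hs x.1 (ball_subset_ball (min_le_right _ _) hx.1)).le
      gcongr
      refine norm_sum_le_of_le _ fun j _ => ?_
      rw [norm_mul, norm_pow]
      have hz : ‖x.2‖ < r := by simpa using hx.2
      exact mul_le_of_le_one_right (norm_nonneg _)
        (pow_le_one₀ (norm_nonneg _) (hz.le.trans hr1)))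
    (h := f) (M := M₁) (hfd.mono (by rw [hball]; exact hsub R₁ hrR₁))
    (fun x hx => hM₁ x (by rw [hball]; exact hsub R₁ hrR₁ hx))
  have hDo : IsOpen (ball (0 : E) ρ ×ˢ ball (0 : ℂ) r) := isOpen_ball.prod isOpen_ball
  have hDn : ball (0 : E) ρ ×ˢ ball (0 : ℂ) r ∈ 𝓝 (0 : E × ℂ) :=
    hDo.mem_nhds ⟨mem_ball_self hρ, mem_ball_self hr⟩
  refine ⟨q, b, ?_, fun j => ?_, ?_⟩
  · filter_upwards [hDn] with x hx using hq.differentiableAt (hDo.mem_nhds hx)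
  · filter_upwards [ball_mem_nhds (0 : E) hρ] with w hw
      using (hb j).differentiableAt (isOpen_ball.mem_nhds hw)
  · filter_upwards [hDn] with x hx
    rw [heq x hx, eq_sum_add_pow_mul_of_slopes (fun k => (hA k).2.2) d (hsub R hrR hx)]

end WeierstrassDivision

/-! ### Rings of holomorphic germs and Rückert's basis theorem. -/

section HolomorphicGerms

open Metric

variable {E F : Type*} [NormedAddCommGroup E] [NormedSpace ℂ E]
  [NormedAddCommGroup F] [NormedSpace ℂ F]

/-- The ring of germs at `p` of holomorphic functions on a complex normed space. -/
def holomorphicGerms (p : E) : Subring (Germ (𝓝 p) ℂ) where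
  carrier := {g | ∃ f : E → ℂ, (∀ᶠ x in 𝓝 p, DifferentiableAt ℂ f x) ∧
    (f : Germ (𝓝 p) ℂ) = g}
  mul_mem' := by
    rintro _ _ ⟨f, hf, rfl⟩ ⟨g, hg, rfl⟩
    refine ⟨f * g, ?_, rfl⟩
    filter_upwards [hf, hg] with x h1 h2 using h1.mul h2
  one_mem' := ⟨1, Eventually.of_forall fun x => differentiableAt_const (1 : ℂ), rfl⟩
  add_mem' := by
    rintro _ _ ⟨f, hf, rfl⟩ ⟨g, hg, rfl⟩
    refine ⟨f + g, ?_, rfl⟩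
    filter_upwards [hf, hg] with x h1 h2 using h1.add h2
  zero_mem' := ⟨0, Eventually.of_forall fun x => differentiableAt_const (0 : ℂ), rfl⟩
  neg_mem' := by
    rintro _ ⟨f, hf, rfl⟩
    refine ⟨-f, ?_, rfl⟩
    filter_upwards [hf] with x h1 using h1.neg

namespace holomorphicGerms

/-- The germ of a function that is holomorphic near `p`. -/
def mk {p : E} (f : E → ℂ) (hf : ∀ᶠ x in 𝓝 p, DifferentiableAt ℂ f x) : holomorphicGerms p :=
  ⟨(f : Germ (𝓝 p) ℂ), f, hf, rfl⟩

theorem exists_rep {p : E} (x : holomorphicGerms p) :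
    ∃ (f : E → ℂ) (hf : ∀ᶠ x in 𝓝 p, DifferentiableAt ℂ f x), x = mk f hf := by
  obtain ⟨_, f, hf, rfl⟩ := x
  exact ⟨f, hf, rfl⟩

theorem mk_eq_mk {p : E} {f g : E → ℂ} {hf : ∀ᶠ x in 𝓝 p, DifferentiableAt ℂ f x}
    {hg : ∀ᶠ x in 𝓝 p, DifferentiableAt ℂ g x} : mk f hf = mk g hg ↔ f =ᶠ[𝓝 p] g := by
  rw [Subtype.ext_iff]
  exact Germ.coe_eq

/-- The germ of a constant function. -/
def const (p : E) : ℂ →+* holomorphicGerms p where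
  toFun c := mk (fun _ => c) (Eventually.of_forall fun _ => differentiableAt_const c)
  map_one' := rfl
  map_zero' := rfl
  map_add' _ _ := rfl
  map_mul' _ _ := rfl

/-- Composition of germs with a holomorphic map. -/
def pullback (φ : E → F) (hφ : Differentiable ℂ φ) {p : E} {q : F} (hq : φ p = q) :
    holomorphicGerms q →+* holomorphicGerms p where
  toFun x := ⟨x.1.compTendsto φ (hq ▸ hφ.continuous.continuousAt), by
    obtain ⟨_, f, hf, rfl⟩ := x
    have ht : Tendsto φ (𝓝 p) (𝓝 q) := hq ▸ hφ.continuous.continuousAt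
    exact ⟨f ∘ φ, (ht.eventually hf).mono fun x hx => hx.comp x (hφ x), rfl⟩⟩
  map_one' := rfl
  map_zero' := rfl
  map_add' := by
    rintro ⟨_, f, hf, rfl⟩ ⟨_, g, hg, rfl⟩
    rfl
  map_mul' := by
    rintro ⟨_, f, hf, rfl⟩ ⟨_, g, hg, rfl⟩
    rfl

theorem eventually_comp {φ : E → F} (hφ : Differentiable ℂ φ) {p : E} {q : F} (hq : φ p = q)
    {f : F → ℂ} (hf : ∀ᶠ x in 𝓝 q, DifferentiableAt ℂ f x) :
    ∀ᶠ x in 𝓝 p, DifferentiableAt ℂ (f ∘ φ) x := by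
  have ht : Tendsto φ (𝓝 p) (𝓝 q) := hq ▸ hφ.continuous.continuousAt
  exact (ht.eventually hf).mono fun x hx => hx.comp x (hφ x)

theorem pullback_mk {φ : E → F} (hφ : Differentiable ℂ φ) {p : E} {q : F} (hq : φ p = q)
    {f : F → ℂ} (hf : ∀ᶠ x in 𝓝 q, DifferentiableAt ℂ f x) :
    pullback φ hφ hq (mk f hf) = mk (f ∘ φ) (eventually_comp hφ hq hf) := rfl

theorem pullback_surjective {φ : E → F} (hφ : Differentiable ℂ φ) {ψ : F → E}
    (hψ : Differentiable ℂ ψ) (h : ∀ x, ψ (φ x) = x) {p : E} {q : F} (hq : φ p = q) :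
    Function.Surjective (pullback φ hφ hq) := by
  intro x
  obtain ⟨f, hf, rfl⟩ := exists_rep x
  refine ⟨mk (f ∘ ψ) (eventually_comp hψ (by rw [← hq, h]) hf), ?_⟩
  rw [pullback_mk, mk_eq_mk]
  exact Eventually.of_forall fun x => by simp [h]

/-- The ring isomorphism induced by a linear change of coordinates. -/
def congr (L : E ≃L[ℂ] E) : holomorphicGerms (0 : E) ≃+* holomorphicGerms (0 : E) :=
  RingEquiv.ofRingHom (pullback L L.differentiable (map_zero L))
    (pullback L.symm L.symm.differentiable (map_zero L.symm))
    (by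
      ext1 x
      obtain ⟨f, hf, rfl⟩ := exists_rep x
      simp only [RingHom.comp_apply, pullback_mk, RingHom.id_apply, mk_eq_mk]
      exact Eventually.of_forall fun x => by simp)
    (by
      ext1 x
      obtain ⟨f, hf, rfl⟩ := exists_rep x
      simp only [RingHom.comp_apply, pullback_mk, RingHom.id_apply, mk_eq_mk]
      exact Eventually.of_forall fun x => by simp)

theorem congr_mk (L : E ≃L[ℂ] E) {f : E → ℂ} (hf : ∀ᶠ x in 𝓝 0, DifferentiableAt ℂ f x) :
    congr L (mk f hf) = mk (f ∘ L) (eventually_comp L.differentiable (map_zero L) hf) := rfl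

theorem isNoetherianRing_of_subsingleton [Subsingleton E] (p : E) :
    IsNoetherianRing (holomorphicGerms p) := by
  refine isNoetherianRing_of_surjective ℂ _ (const p) fun x => ?_
  obtain ⟨f, hf, rfl⟩ := exists_rep x
  refine ⟨f p, (mk_eq_mk (hf := Eventually.of_forall fun _ => differentiableAt_const _)).2
    (Eventually.of_forall fun x => ?_)⟩
  rw [Subsingleton.elim x p]

/-- An ideal that contains a germ regular in the last variable is finitely generated. -/
theorem fg_of_regular_mem [IsNoetherianRing (holomorphicGerms (0 : E))]
    (J : Ideal (holomorphicGerms (0 : E × ℂ))) {g : E × ℂ → ℂ}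
    (hg : ∀ᶠ x in 𝓝 0, DifferentiableAt ℂ g x) (hg0 : ∃ᶠ z in 𝓝 (0 : ℂ), g (0, z) ≠ 0)
    (hgJ : mk g hg ∈ J) : J.FG := by
  obtain ⟨d, hd⟩ := weierstrass_division hg hg0
  let inc : holomorphicGerms (0 : E) →+* holomorphicGerms (0 : E × ℂ) :=
    pullback Prod.fst differentiable_fst rfl
  let : Algebra (holomorphicGerms (0 : E)) (holomorphicGerms (0 : E × ℂ)) := inc.toAlgebra
  let Z : holomorphicGerms (0 : E × ℂ) :=
    mk Prod.snd (Eventually.of_forall fun _ => differentiableAt_snd)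
  let θ := Fintype.linearCombination (holomorphicGerms (0 : E)) (fun j : Fin d => Z ^ (j : ℕ))
  -- Coefficient vectors of polynomials of degree below `d` lying in `J` form a submodule of a
  -- finite free module over the Noetherian ring of germs on `E`. Division by `g` reduces `J` to `g`
  -- and these polynomials.
  obtain ⟨T, hT⟩ := IsNoetherian.noetherian
    ((J.restrictScalars (holomorphicGerms (0 : E))).comap θ)
  have hTJ : θ '' T ⊆ J := by
    rintro _ ⟨a, ha, rfl⟩
    have : a ∈ (J.restrictScalars (holomorphicGerms (0 : E))).comap θ :=
      hT ▸ Submodule.subset_span ha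
    exact this
  have hJ : J = Ideal.span {mk g hg} ⊔ Ideal.span (θ '' T) := by
    refine le_antisymm (fun x hx => ?_) (sup_le ?_ (Ideal.span_le.2 hTJ))
    · obtain ⟨f, hf, rfl⟩ := exists_rep x
      obtain ⟨q, b, hq, hb, heq⟩ := hd f hf
      have hfq : mk f hf = mk q hq * mk g hg + θ (fun j => mk (b j) (hb j)) := by
        have hθ : θ (fun j => mk (b j) (hb j)) =
            ∑ j : Fin d, inc (mk (b j) (hb j)) * Z ^ (j : ℕ) := by
          simp only [θ, Fintype.linearCombination_apply]
          rfl
        have hsum : ∀ s : Finset (Fin d), ((∑ j ∈ s, inc (mk (b j) (hb j)) * Z ^ (j : ℕ) :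
            holomorphicGerms (0 : E × ℂ)) : Germ (𝓝 (0 : E × ℂ)) ℂ) =
            ((fun x => ∑ j ∈ s, b j x.1 * x.2 ^ (j : ℕ) : E × ℂ → ℂ) :
              Germ (𝓝 (0 : E × ℂ)) ℂ) := by
          classical
          intro s
          induction s using Finset.induction_on with
          | empty => rfl
          | insert a s ha ih =>
            rw [Finset.sum_insert ha, Subring.coe_add, ih]
            simp only [Finset.sum_insert ha]
            rfl
        rw [Subtype.ext_iff, hθ, Subring.coe_add, hsum]
        refine Germ.coe_eq.2 ?_
        filter_upwards [heq] with x hx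
        rw [hx, Finset.sum_range]
      have hθJ : θ (fun j => mk (b j) (hb j)) ∈ J := by
        have : θ (fun j => mk (b j) (hb j)) = mk f hf - mk q hq * mk g hg := by
          rw [hfq]; ring
        rw [this]
        exact J.sub_mem hx (J.mul_mem_left _ hgJ)
      have hmem : (fun j : Fin d => mk (b j) (hb j)) ∈
          Submodule.span (holomorphicGerms (0 : E)) (T : Set (Fin d → holomorphicGerms (0 : E))) :=
        hT ▸ hθJ
      have hspan : θ (fun j => mk (b j) (hb j)) ∈ Ideal.span (θ '' T) := by
        have h1 := Submodule.mem_map_of_mem (f := θ) hmem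
        rw [Submodule.map_span] at h1
        exact Submodule.span_le_restrictScalars (holomorphicGerms (0 : E))
          (holomorphicGerms (0 : E × ℂ)) _ h1
      rw [hfq]
      exact Submodule.add_mem_sup
        (Ideal.mul_mem_left _ _ (Ideal.subset_span rfl)) hspan
    · rw [Ideal.span_le, Set.singleton_subset_iff]
      exact hgJ
  rw [hJ]
  exact (Submodule.fg_span (Set.finite_singleton _)).sup
    (Submodule.fg_span ((Finset.finite_toSet T).image θ))

/-- A nonzero germ is regular in the last variable after a linear change of coordinates. -/
theorem exists_linear_regular {g : E × ℂ → ℂ} (hg : ∀ᶠ x in 𝓝 0, DifferentiableAt ℂ g x)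
    (hg0 : ∃ᶠ x in 𝓝 (0 : E × ℂ), g x ≠ 0) :
    ∃ L : (E × ℂ) ≃L[ℂ] (E × ℂ), ∃ᶠ z in 𝓝 (0 : ℂ), g (L (0, z)) ≠ 0 := by
  obtain ⟨R, hR, hball⟩ := Metric.eventually_nhds_iff_ball.1 hg
  obtain ⟨x, hx0, hx⟩ := (hg0.and_eventually (ball_mem_nhds 0 hR)).exists
  by_cases hxz : x = 0
  · refine ⟨ContinuousLinearEquiv.refl ℂ _, Eventually.frequently ?_⟩
    have h1 : Tendsto (fun z : ℂ => ((0 : E), z)) (𝓝 0) (𝓝 0) :=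
      Continuous.tendsto' (by fun_prop) _ _ rfl
    exact h1.eventually ((hball 0 (mem_ball_self hR)).continuousAt.eventually_ne (hxz ▸ hx0))
  -- `L` carries the last axis to the complex line through a point `x` with `g x ≠ 0`. The line
  -- meets the ball in a convex set, so by the identity theorem vanishing near 0 on it would give `g
  -- x = 0`.
  · obtain ⟨L, hL⟩ := SeparatingDual.exists_continuousLinearEquiv_apply_eq (R := ℂ)
      (x := ((0 : E), (1 : ℂ))) (y := x) (by simp) hxz
    refine ⟨L, fun hev => hx0 ?_⟩
    have hLz : ∀ z : ℂ, L (0, z) = z • x := fun z => by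
      rw [← hL, ← map_smul]; simp
    simp only [hLz, not_not] at hev
    set s : Set ℂ := (fun z : ℂ => z • x) ⁻¹' ball 0 R with hs
    have hso : IsOpen s := isOpen_ball.preimage (by fun_prop)
    have hsc : IsPreconnected s := by
      refine Convex.isPreconnected ?_
      exact (convex_ball (0 : E × ℂ) R).is_linear_preimage
        ⟨fun a b => add_smul a b x, fun c a => smul_assoc c a x⟩
    have han : AnalyticOnNhd ℂ (fun z : ℂ => g (z • x)) s := by
      refine DifferentiableOn.analyticOnNhd (fun z hz => ?_) hso
      exact (DifferentiableAt.comp (f := fun z : ℂ => z • x) z (hball _ hz)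
        (by fun_prop)).differentiableWithinAt
    have h1 : (1 : ℂ) ∈ s := by simpa [hs] using hx
    have h0 : (0 : ℂ) ∈ s := by simpa [hs] using hR
    simpa using han.eqOn_zero_of_preconnected_of_eventuallyEq_zero hsc h0 hev h1

/-- A nonzero ideal contains a germ that a linear change of coordinates makes regular in the last
variable; finite generation is carried back along the induced ring automorphism. -/
theorem isNoetherianRing_prod [IsNoetherianRing (holomorphicGerms (0 : E))] :
    IsNoetherianRing (holomorphicGerms (0 : E × ℂ)) := by
  rw [isNoetherianRing_iff_ideal_fg]
  intro J
  by_cases hJ : J = ⊥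
  · exact hJ ▸ Submodule.fg_bot
  · obtain ⟨x, hxJ, hx0⟩ := Submodule.exists_mem_ne_zero_of_ne_bot hJ
    obtain ⟨g, hg, rfl⟩ := exists_rep x
    have hg0 : ∃ᶠ x in 𝓝 (0 : E × ℂ), g x ≠ 0 := fun hev => hx0 <| by
      have : mk g hg = mk (fun _ => 0) (Eventually.of_forall fun _ => differentiableAt_const 0) :=
        mk_eq_mk.2 (hev.mono fun x hx => not_not.1 hx)
      exact this
    obtain ⟨L, hL⟩ := exists_linear_regular hg hg0
    have hmem : mk (g ∘ L) (eventually_comp L.differentiable (map_zero L) hg) ∈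
        J.map (congr L) := by
      rw [← congr_mk L hg]
      exact Ideal.mem_map_of_mem _ hxJ
    have hfg := (fg_of_regular_mem (J.map (congr L)) _ hL hmem).map (congr L).symm.toRingHom
    have hmap : (J.map (congr L)).map (congr L).symm.toRingHom = J :=
      Ideal.map_of_equiv (congr L)
    rwa [hmap] at hfg

/-- Rückert's basis theorem. -/
theorem isNoetherianRing_pi_zero (n : ℕ) :
    IsNoetherianRing (holomorphicGerms (0 : Fin n → ℂ)) := by
  induction n with
  | zero => exact isNoetherianRing_of_subsingleton 0
  | succ n ih =>
    have := isNoetherianRing_prod (E := Fin n → ℂ)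
    let φ : (Fin (n + 1) → ℂ) → (Fin n → ℂ) × ℂ := fun x => (fun i => x i.succ, x 0)
    let ψ : (Fin n → ℂ) × ℂ → Fin (n + 1) → ℂ := fun y => Fin.cons y.2 y.1
    have hφ : Differentiable ℂ φ := by fun_prop
    have hψ : Differentiable ℂ ψ := by
      refine differentiable_pi.2 fun i => ?_
      refine Fin.cases ?_ (fun i => ?_) i
      · simp only [ψ, Fin.cons_zero]; fun_prop
      · simp only [ψ, Fin.cons_succ]; fun_prop
    refine isNoetherianRing_of_surjective _ _ (pullback φ hφ (p := 0) (q := 0) rfl)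
      (pullback_surjective hφ hψ (fun x => ?_) rfl)
    ext i
    refine Fin.cases ?_ (fun i => ?_) i <;> simp [φ, ψ]

end holomorphicGerms

end HolomorphicGerms

/-! ### Cartan's closure theorem for ideals of germs. -/

section ClosureOfIdeals

open Metric

theorem DifferentiableOn.eventually_differentiableAt_ball {E : Type*} [NormedAddCommGroup E]
    [NormedSpace ℂ E] {p : E} {r : ℝ} (hr : 0 < r) {f : E → ℂ}
    (hf : DifferentiableOn ℂ f (ball p r)) : ∀ᶠ x in 𝓝 p, DifferentiableAt ℂ f x :=
  hf.eventually_differentiableAt (ball_mem_nhds p hr)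

namespace holomorphicGerms

/-- The value of a germ at the base point. -/
def eval {E : Type*} [NormedAddCommGroup E] [NormedSpace ℂ E] (p : E) :
    holomorphicGerms p →+* ℂ :=
  Germ.valueRingHom.comp (holomorphicGerms p).subtype

theorem eval_mk {E : Type*} [NormedAddCommGroup E] [NormedSpace ℂ E] {p : E} {f : E → ℂ}
    (hf : ∀ᶠ x in 𝓝 p, DifferentiableAt ℂ f x) : eval p (mk f hf) = f p := rfl

theorem isUnit_of_eval_ne_zero {E : Type*} [NormedAddCommGroup E] [NormedSpace ℂ E] {p : E}
    {x : holomorphicGerms p} (hx : eval p x ≠ 0) : IsUnit x := by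
  obtain ⟨f, hf, rfl⟩ := exists_rep x
  rw [eval_mk] at hx
  have hne := hf.self_of_nhds.continuousAt.eventually_ne hx
  have hinv : ∀ᶠ x in 𝓝 p, DifferentiableAt ℂ (fun x => (f x)⁻¹) x := by
    filter_upwards [hf, hne] with x h1 h2 using h1.inv h2
  refine IsUnit.of_mul_eq_one (mk _ hinv) (Subtype.ext (Germ.coe_eq.2 ?_))
  filter_upwards [hne] with x h2 using mul_inv_cancel₀ h2

/-- Krull's intersection theorem for the ring of germs. -/
theorem mem_of_forall_mem_sup_pow {E : Type*} [NormedAddCommGroup E] [NormedSpace ℂ E] {p : E}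
    [IsNoetherianRing (holomorphicGerms p)] (I : Ideal (holomorphicGerms p))
    {x : holomorphicGerms p} (hx : ∀ j : ℕ, x ∈ I ⊔ RingHom.ker (eval p) ^ j) : x ∈ I := by
  set m := RingHom.ker (eval p) with hm
  have hjac : m ≤ Ideal.jacobson ⊥ := fun y hy => Ideal.mem_jacobson_bot.2 fun z =>
    isUnit_of_eval_ne_zero (by
      rw [map_add, map_mul, (RingHom.mem_ker).1 hy, zero_mul, zero_add, map_one]
      exact one_ne_zero)
  -- Krull is applied to the quotient module by `I`, where the hypothesis places the class of `x` in
  -- every power of the maximal ideal.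
  have hbot := Ideal.iInf_pow_smul_eq_bot_of_le_jacobson (M := holomorphicGerms p ⧸ I) m hjac
  rw [← Ideal.Quotient.eq_zero_iff_mem, ← Submodule.mem_bot (holomorphicGerms p), ← hbot,
    Submodule.mem_iInf]
  intro j
  obtain ⟨a, ha, b, hb, rfl⟩ := Submodule.mem_sup.1 (hx j)
  rw [map_add, Ideal.Quotient.eq_zero_iff_mem.2 ha, zero_add]
  have : (Ideal.Quotient.mk I b) = b • (1 : holomorphicGerms p ⧸ I) := by
    rw [Algebra.smul_def, mul_one]; rfl
  rw [this]
  exact Submodule.smul_mem_smul hb trivial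

/-- Hadamard's lemma with bounds: the coordinates are set to zero one at a time. The bound does not
deteriorate, since each division is applied to `h` with some coordinates frozen at 0, still bounded
by `M`. -/
theorem exists_coordinate_decomposition {n : ℕ} {r : ℝ} (hr : 0 < r) {h : (Fin n → ℂ) → ℂ}
    (hh : DifferentiableOn ℂ h (ball 0 r)) {M : ℝ} (hM : ∀ x ∈ ball 0 r, ‖h x‖ ≤ M) :
    ∃ g : Fin n → (Fin n → ℂ) → ℂ, (∀ i, DifferentiableOn ℂ (g i) (ball 0 r)) ∧
      (∀ i, ∀ x ∈ ball 0 r, ‖g i x‖ ≤ 2 * M / r) ∧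
      ∀ x ∈ ball 0 r, h x = h 0 + ∑ i, x i * g i x := by
  classical
  have hball : ∀ x : Fin n → ℂ, x ∈ ball 0 r ↔ ∀ i, ‖x i‖ < r := fun x => by
    rw [mem_ball_zero_iff, pi_norm_lt_iff hr]
  have hM0 : 0 ≤ M := (norm_nonneg _).trans (hM 0 (mem_ball_self hr))
  have hpw : ∀ (s : Finset (Fin n)) (x : Fin n → ℂ), x ∈ ball 0 r → s.piecewise 0 x ∈ ball 0 r := by
    intro s x hx
    rw [hball] at hx ⊢
    intro i
    by_cases hi : i ∈ s
    · simpa [hi] using hr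
    · simpa [hi] using hx i
  have key : ∀ s : Finset (Fin n), ∃ g : Fin n → (Fin n → ℂ) → ℂ,
      (∀ i, DifferentiableOn ℂ (g i) (ball 0 r)) ∧
      (∀ i, ∀ x ∈ ball 0 r, ‖g i x‖ ≤ 2 * M / r) ∧
      ∀ x ∈ ball 0 r, h x = h (s.piecewise 0 x) + ∑ i ∈ s, x i * g i x := by
    intro s
    induction s using Finset.induction_on with
    | empty =>
      refine ⟨fun _ _ => 0, fun _ => differentiableOn_const 0, fun _ _ _ => ?_, fun x _ => by simp⟩
      rw [norm_zero]; positivity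
    | insert a s ha ih =>
      obtain ⟨g, hg, hgM, heq⟩ := ih
      have hpd : Differentiable ℂ fun x : Fin n → ℂ => s.piecewise (0 : Fin n → ℂ) x := by
        refine differentiable_pi.2 fun i => ?_
        by_cases hi : i ∈ s
        · simp only [Finset.piecewise_eq_of_mem _ _ _ hi]
          exact differentiable_const _
        · simp only [Finset.piecewise_eq_of_notMem _ _ _ hi]
          fun_prop
      obtain ⟨k, hk, hkM, hkeq⟩ := exists_eq_add_coord_mul
        (ContinuousLinearMap.proj (R := ℂ) (φ := fun _ : Fin n => ℂ) a) (Pi.single a 1)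
        (by simp) isOpen_ball hr (fun x hx => (hball x).1 hx a) (fun x hx t ht => by
          rw [hball] at hx ⊢
          intro i
          by_cases hi : i = a
          · subst hi; simpa using ht
          · simpa [hi] using hx i)
        (h := fun x => h (s.piecewise 0 x)) (hh.comp hpd.differentiableOn fun x hx => hpw s x hx)
        (fun x hx => hM _ (hpw s x hx))
      refine ⟨Function.update g a k, fun i => ?_, fun i => ?_, fun x hx => ?_⟩
      · by_cases hi : i = a
        · subst hi; simpa using hk
        · simpa [hi] using hg i
      · by_cases hi : i = a
        · subst hi; simpa using hkM
        · simpa [hi] using hgM i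
      · rw [heq x hx, hkeq x hx, Finset.sum_insert ha, Function.update_self]
        have h1 : s.piecewise (0 : Fin n → ℂ) (x - (x a) • Pi.single a (1 : ℂ)) =
            (insert a s).piecewise 0 x := by
          ext i
          by_cases hi : i = a
          · subst hi; simp [ha]
          · by_cases his : i ∈ s <;> simp [hi, his]
        have h2 : ∑ i ∈ s, x i * g i x = ∑ i ∈ s, x i * Function.update g a k i x :=
          Finset.sum_congr rfl fun i hi => by
            rw [Function.update_of_ne (ne_of_mem_of_not_mem hi ha)]
        rw [h2]
        simp only [ContinuousLinearMap.proj_apply, h1]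
        ring
  obtain ⟨g, h1, h2, h3⟩ := key Finset.univ
  refine ⟨g, h1, h2, fun x hx => ?_⟩
  rw [h3 x hx, Finset.piecewise_univ]

/-- Modulo a power of the maximal ideal, bounded holomorphic functions are combinations of finitely
many germs, with coefficients that are bounded in terms of the sup-norm. -/
theorem exists_bounded_jets {n : ℕ} {r : ℝ} (hr : 0 < r) (j : ℕ) :
    ∃ (ι : Type) (_ : Fintype ι) (e : ι → holomorphicGerms (0 : Fin n → ℂ)) (C : ℝ),
      ∀ (h : (Fin n → ℂ) → ℂ) (hh : DifferentiableOn ℂ h (ball 0 r)) (M : ℝ),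
        (∀ x ∈ ball 0 r, ‖h x‖ ≤ M) → ∃ c : ι → ℂ, (∀ a, ‖c a‖ ≤ C * M) ∧
          mk h (hh.eventually_differentiableAt_ball hr) - ∑ a, const 0 (c a) * e a ∈
            RingHom.ker (eval (0 : Fin n → ℂ)) ^ j := by
  induction j with
  | zero =>
    refine ⟨Empty, inferInstance, Empty.elim, 0, fun h hh M hM => ⟨Empty.elim, fun a => a.elim, ?_⟩⟩
    rw [pow_zero, Ideal.one_eq_top]
    trivial
  | succ j ih =>
    obtain ⟨ι, _, e, C, hC⟩ := ih
    let Z : Fin n → holomorphicGerms (0 : Fin n → ℂ) := fun i =>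
      mk (fun x => x i) (Eventually.of_forall fun x => by fun_prop)
    -- `none` carries the constant term `h 0`; `some (i, a)` carries the `a`-th coefficient of the
    -- factor of the `i`-th coordinate.
    refine ⟨Option (Fin n × ι), inferInstance,
      fun o => o.elim 1 fun q => Z q.1 * e q.2, max 1 (C * (2 / r)), fun h hh M hM => ?_⟩
    have hM0 : 0 ≤ M := (norm_nonneg _).trans (hM 0 (mem_ball_self hr))
    obtain ⟨g, hg, hgM, heq⟩ := exists_coordinate_decomposition hr hh hM
    choose c hc hmem using fun i => hC (g i) (hg i) (2 * M / r) (hgM i)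
    refine ⟨fun o => o.elim (h 0) fun q => c q.1 q.2, fun o => ?_, ?_⟩
    · cases o with
      | none =>
        calc ‖h 0‖ ≤ 1 * M := by rw [one_mul]; exact hM 0 (mem_ball_self hr)
          _ ≤ _ := by gcongr; exact le_max_left _ _
      | some q =>
        calc ‖c q.1 q.2‖ ≤ C * (2 * M / r) := hc q.1 q.2
          _ = C * (2 / r) * M := by ring
          _ ≤ _ := by gcongr; exact le_max_right _ _
    · have hdec : mk h (hh.eventually_differentiableAt_ball hr) = const 0 (h 0) +
          ∑ i, Z i * mk (g i) ((hg i).eventually_differentiableAt_ball hr) := by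
        have hsum : ∀ s : Finset (Fin n), ((∑ i ∈ s, Z i *
            mk (g i) ((hg i).eventually_differentiableAt_ball hr) :
            holomorphicGerms (0 : Fin n → ℂ)) : Germ (𝓝 (0 : Fin n → ℂ)) ℂ) =
            ((fun x => ∑ i ∈ s, x i * g i x : (Fin n → ℂ) → ℂ) :
              Germ (𝓝 (0 : Fin n → ℂ)) ℂ) := by
          classical
          intro s
          induction s using Finset.induction_on with
          | empty => rfl
          | insert a s ha ih =>
            rw [Finset.sum_insert ha, Subring.coe_add, ih]
            simp only [Finset.sum_insert ha]
            rfl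
        rw [Subtype.ext_iff, Subring.coe_add, hsum]
        refine Germ.coe_eq.2 ?_
        filter_upwards [ball_mem_nhds 0 hr] with x hx using heq x hx
      have hfin : mk h (hh.eventually_differentiableAt_ball hr) -
          ∑ o : Option (Fin n × ι), const 0 (o.elim (h 0) fun q => c q.1 q.2) *
            (o.elim 1 fun q => Z q.1 * e q.2) =
          ∑ i, Z i * (mk (g i) ((hg i).eventually_differentiableAt_ball hr) -
            ∑ a, const 0 (c i a) * e a) := by
        rw [hdec, Fintype.sum_option, Fintype.sum_prod_type]
        simp only [Option.elim, mul_sub, Finset.sum_sub_distrib, Finset.mul_sum, mul_one]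
        rw [add_sub_add_left_eq_sub]
        congr 1
        refine Finset.sum_congr rfl fun i _ => Finset.sum_congr rfl fun a _ => ?_
        ring
      rw [hfin]
      refine Ideal.sum_mem _ fun i _ => ?_
      rw [pow_succ']
      exact Ideal.mul_mem_mul rfl (hmem i)

/-- For each `j`, the coefficient vectors representing elements of `I ⊔ m ^ j` form a
finite-dimensional, hence closed, subspace `W`. Adding small jets of `f k - g` to a jet of `g` lands
in `W`, so the jet of `g` lies in `W`; no linear choice of coefficients is needed. -/
theorem mem_of_tendstoUniformlyOn_zero {n : ℕ}
    (I : Ideal (holomorphicGerms (0 : Fin n → ℂ))) {r : ℝ} (hr : 0 < r)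
    {f : ℕ → (Fin n → ℂ) → ℂ} {g : (Fin n → ℂ) → ℂ}
    (hf : ∀ k, DifferentiableOn ℂ (f k) (ball 0 r)) (hg : DifferentiableOn ℂ g (ball 0 r))
    (hfg : TendstoUniformlyOn f g atTop (ball 0 r))
    (hI : ∀ k, mk (f k) ((hf k).eventually_differentiableAt_ball hr) ∈ I) :
    mk g (hg.eventually_differentiableAt_ball hr) ∈ I := by
  have := isNoetherianRing_pi_zero n
  obtain ⟨r', hr', hr'r, M, hM⟩ : ∃ r' > 0, r' ≤ r ∧ ∃ M : ℝ, ∀ x ∈ ball 0 r', ‖g x‖ ≤ M := by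
    obtain ⟨R, hR, -, M, -, hM⟩ := exists_ball_differentiableOn_norm_le
      (hg.eventually_differentiableAt_ball hr)
    exact ⟨min R r, by positivity, min_le_right _ _, M,
      fun x hx => hM x (ball_subset_ball (min_le_left _ _) hx)⟩
  have hsub : ball (0 : Fin n → ℂ) r' ⊆ ball 0 r := ball_subset_ball hr'r
  refine mem_of_forall_mem_sup_pow I fun j => ?_
  obtain ⟨ι, _, e, C, hC⟩ := exists_bounded_jets (n := n) hr' j
  set m := RingHom.ker (eval (0 : Fin n → ℂ)) with hm
  obtain ⟨c, -, hc⟩ := hC g (hg.mono hsub) M hM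
  let W : Submodule ℂ (ι → ℂ) :=
    { carrier := {c | ∑ a, const 0 (c a) * e a ∈ I ⊔ m ^ j}
      add_mem' := fun {x y} hx hy => by
        simp only [mem_ofPred_eq, Pi.add_apply, map_add, add_mul, Finset.sum_add_distrib] at *
        exact add_mem hx hy
      zero_mem' := by simp
      smul_mem' := fun t x hx => by
        simp only [mem_ofPred_eq, Pi.smul_apply, smul_eq_mul, map_mul, mul_assoc] at *
        rw [← Finset.mul_sum]
        exact Ideal.mul_mem_left _ _ hx }
  have hfg' : ∀ ε > 0, ∀ᶠ k in atTop, ∀ x ∈ ball (0 : Fin n → ℂ) r', ‖f k x - g x‖ ≤ ε := by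
    intro ε hε
    filter_upwards [Metric.tendstoUniformlyOn_iff.1 hfg ε hε] with k hk x hx
    rw [← dist_eq_norm, dist_comm]
    exact (hk x (hsub hx)).le
  have hcW : c ∈ closure (W : Set (ι → ℂ)) := by
    rw [Metric.mem_closure_iff]
    intro δ hδ
    -- Makes `C * ε ≤ δ / 2` whatever the sign of `C`.
    set ε := δ / (2 * (|C| + 1)) with hε
    have hε0 : 0 < ε := by positivity
    obtain ⟨k, hk⟩ := (hfg' ε hε0).exists
    obtain ⟨b, hb, hbm⟩ := hC (fun x => f k x - g x) (((hf k).sub hg).mono hsub) ε hk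
    refine ⟨c + b, ?_, ?_⟩
    · have h1 : ∑ a, const 0 ((c + b) a) * e a =
          mk (f k) ((hf k).eventually_differentiableAt_ball hr) -
          ((mk g ((hg.mono hsub).eventually_differentiableAt_ball hr') -
              ∑ a, const 0 (c a) * e a) +
            (mk (fun x => f k x - g x)
              ((((hf k).sub hg).mono hsub).eventually_differentiableAt_ball hr') -
              ∑ a, const 0 (b a) * e a)) := by
        have h2 : mk (fun x => f k x - g x)
            ((((hf k).sub hg).mono hsub).eventually_differentiableAt_ball hr') =
            mk (f k) ((hf k).eventually_differentiableAt_ball hr) -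
            mk g ((hg.mono hsub).eventually_differentiableAt_ball hr') := rfl
        simp only [h2, Pi.add_apply, map_add, add_mul, Finset.sum_add_distrib]
        ring
      change ∑ a, const 0 ((c + b) a) * e a ∈ I ⊔ m ^ j
      rw [h1]
      exact sub_mem (Ideal.mem_sup_left (hI k)) (Ideal.mem_sup_right (add_mem hc hbm))
    · rw [dist_eq_norm, sub_add_cancel_left, norm_neg]
      refine ((pi_norm_le_iff_of_nonneg (by positivity)).2
        (fun a => (hb a).trans ?_)).trans_lt (half_lt_self hδ)
      calc C * ε ≤ (|C| + 1) * ε := by gcongr; linarith [le_abs_self C]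
        _ = δ / 2 := by rw [hε]; field_simp
  have hcW' : c ∈ W := by
    have := W.closed_of_finiteDimensional.closure_eq
    rw [this] at hcW
    exact hcW
  have h3 := add_mem (show _ ∈ I ⊔ m ^ j from Ideal.mem_sup_right hc) hcW'
  rwa [sub_add_cancel] at h3

/-- Cartan's closure theorem for ideals of germs. -/
theorem mem_of_tendstoUniformlyOn {n : ℕ} {p : Fin n → ℂ}
    (I : Ideal (holomorphicGerms p)) {r : ℝ} (hr : 0 < r)
    {f : ℕ → (Fin n → ℂ) → ℂ} {g : (Fin n → ℂ) → ℂ}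
    (hf : ∀ k, DifferentiableOn ℂ (f k) (ball p r)) (hg : DifferentiableOn ℂ g (ball p r))
    (hfg : TendstoUniformlyOn f g atTop (ball p r))
    (hI : ∀ k, mk (f k) ((hf k).eventually_differentiableAt_ball hr) ∈ I) :
    mk g (hg.eventually_differentiableAt_ball hr) ∈ I := by
  have hτ : Differentiable ℂ fun x : Fin n → ℂ => x - p := by fun_prop
  have hmaps : MapsTo (fun x : Fin n → ℂ => x + p) (ball 0 r) (ball p r) := fun x hx => by
    simpa [mem_ball, dist_eq_norm] using hx
  have hd : ∀ {h : (Fin n → ℂ) → ℂ}, DifferentiableOn ℂ h (ball p r) →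
      DifferentiableOn ℂ (fun x => h (x + p)) (ball 0 r) := fun hh =>
    hh.comp (by fun_prop) hmaps
  let T := pullback (fun x : Fin n → ℂ => x - p) hτ (p := p) (q := 0) (sub_self p)
  have hT : ∀ (h : (Fin n → ℂ) → ℂ) (hh : DifferentiableOn ℂ h (ball p r)),
      T (mk (fun x => h (x + p)) ((hd hh).eventually_differentiableAt_ball hr)) =
        mk h (hh.eventually_differentiableAt_ball hr) := fun h hh => by
    simp only [T, pullback_mk, mk_eq_mk]
    exact Eventually.of_forall fun x => by simp
  rw [← hT g hg, ← Ideal.mem_comap]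
  refine mem_of_tendstoUniformlyOn_zero (I.comap T) hr (f := fun k x => f k (x + p))
    (fun k => hd (hf k)) (hd hg) ?_ fun k => ?_
  · exact fun u hu => (hfg u hu).mono fun k hk x hx => hk _ (hmaps hx)
  · rw [Ideal.mem_comap, hT _ (hf k)]
    exact hI k

end holomorphicGerms

end ClosureOfIdeals

/-! ### Multiplier ideals and weighted L² seminorms. -/

section MultiplierIdeal

open Metric

variable {n : ℕ} {φ : (Fin n → ℂ) → EReal}

/-- Upper semicontinuous functions are Borel, and so is the smooth summand. -/
theorem IsQuasiPsh.exists_aemeasurable_exp {B : Set (Fin n → ℂ)} (hφ : IsQuasiPsh φ B)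
    {p : Fin n → ℂ} (hp : p ∈ B) :
    ∃ U, IsOpen U ∧ p ∈ U ∧ U ⊆ B ∧
      AEMeasurable (fun x => EReal.exp (-2 * φ x)) (volume.restrict U) := by
  obtain ⟨U, hU, hpU, hUB, ψ, ρ, hψ, hρ, heq⟩ := hφ p hp
  refine ⟨U, hU, hpU, hUB, aemeasurable_restrict_of_measurable_subtype hU.measurableSet ?_⟩
  have h1 : Measurable fun x : U => ψ x :=
    (upperSemicontinuousOn_iff_restrict.2 hψ.usc).measurable
  have h2 : Measurable fun x : U => ((ρ x : ℝ) : EReal) :=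
    measurable_coe_real_ereal.comp
      (continuousOn_iff_continuous_domRestrict.1 hρ.continuousOn).measurable
  have h3 : (fun x : U => φ x) = fun x : U => ψ x + (ρ x : EReal) := funext fun x => heq x x.2
  have h4 : Measurable fun x : U => φ x := h3 ▸ h1.add h2
  exact EReal.measurable_exp.comp (h4.const_mul (-2))

/-- The measure `e^{-2φ} dx` on `S`. -/
noncomputable def expWeightMeasure (φ : (Fin n → ℂ) → EReal) (S : Set (Fin n → ℂ)) :
    Measure (Fin n → ℂ) :=
  (volume.restrict S).withDensity fun x => EReal.exp (-2 * φ x)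

/-- Moving the weight into the measure makes the triangle inequality and Fatou's lemma for `eLpNorm`
available. The density may take the value `∞`. -/
theorem weightedSqIntegral_eq_eLpNorm {S : Set (Fin n → ℂ)}
    (hw : AEMeasurable (fun x => EReal.exp (-2 * φ x)) (volume.restrict S))
    {f : (Fin n → ℂ) → ℂ} (hf : AEMeasurable f (volume.restrict S)) :
    weightedSqIntegral φ f S = eLpNorm f 2 (expWeightMeasure φ S) ^ 2 := by
  have h1 := eLpNorm_nnreal_pow_eq_lintegral (f := f) (μ := expWeightMeasure φ S) (p := 2)
    two_ne_zero
  simp only [NNReal.coe_ofNat, ENNReal.rpow_ofNat, ENNReal.coe_ofNat] at h1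
  rw [h1, expWeightMeasure, lintegral_withDensity_eq_lintegral_mul₀ hw (hf.enorm.pow_const 2)]
  simp only [weightedSqIntegral, Pi.mul_apply, mul_comm]

theorem aestronglyMeasurable_expWeightMeasure {S : Set (Fin n → ℂ)} {f : (Fin n → ℂ) → ℂ}
    (hf : AEStronglyMeasurable f (volume.restrict S)) :
    AEStronglyMeasurable f (expWeightMeasure φ S) :=
  hf.mono_ac (withDensity_absolutelyContinuous _ _)

theorem weightedSqIntegral_lt_top_iff {S : Set (Fin n → ℂ)}
    (hw : AEMeasurable (fun x => EReal.exp (-2 * φ x)) (volume.restrict S))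
    {f : (Fin n → ℂ) → ℂ} (hf : AEStronglyMeasurable f (volume.restrict S)) :
    weightedSqIntegral φ f S < ⊤ ↔ MemLp f 2 (expWeightMeasure φ S) := by
  rw [weightedSqIntegral_eq_eLpNorm hw hf.aemeasurable, ENNReal.pow_lt_top_iff]
  simp [MemLp, aestronglyMeasurable_expWeightMeasure hf]

theorem weightedSqIntegral_congr {S : Set (Fin n → ℂ)} (hS : MeasurableSet S)
    {f g : (Fin n → ℂ) → ℂ} (h : EqOn f g S) :
    weightedSqIntegral φ f S = weightedSqIntegral φ g S :=
  setLIntegral_congr_fun hS fun x hx => by simp only [h hx]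

theorem weightedSqIntegral_mono {S T : Set (Fin n → ℂ)} (h : S ⊆ T) (f : (Fin n → ℂ) → ℂ) :
    weightedSqIntegral φ f S ≤ weightedSqIntegral φ f T :=
  lintegral_mono_set h

theorem weightedSqIntegral_union_le (S T : Set (Fin n → ℂ)) (f : (Fin n → ℂ) → ℂ) :
    weightedSqIntegral φ f (S ∪ T) ≤ weightedSqIntegral φ f S + weightedSqIntegral φ f T :=
  lintegral_union_le _ _ _

theorem weightedSqIntegral_empty (f : (Fin n → ℂ) → ℂ) : weightedSqIntegral φ f ∅ = 0 := by
  simp [weightedSqIntegral]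

namespace IsMultiplierSection

variable {U : Set (Fin n → ℂ)} {f g : (Fin n → ℂ) → ℂ}

theorem mono (hf : IsMultiplierSection φ U f) {V : Set (Fin n → ℂ)} (hV : V ⊆ U) :
    IsMultiplierSection φ V f :=
  ⟨hf.1.mono hV, fun K hK hc => hf.2 K (hK.trans hV) hc⟩

theorem congr (hf : IsMultiplierSection φ U f) (h : EqOn g f U) : IsMultiplierSection φ U g :=
  ⟨hf.1.congr h, fun K hK hc => by
    rw [weightedSqIntegral_congr hc.measurableSet (h.mono hK)]
    exact hf.2 K hK hc⟩

theorem memLp (hf : IsMultiplierSection φ U f)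
    (hw : AEMeasurable (fun x => EReal.exp (-2 * φ x)) (volume.restrict U))
    {K : Set (Fin n → ℂ)} (hK : K ⊆ U) (hc : IsCompact K) :
    MemLp f 2 (expWeightMeasure φ K) :=
  (weightedSqIntegral_lt_top_iff (hw.mono_measure (Measure.restrict_mono_set _ hK))
    ((hf.1.continuousOn.mono hK).aestronglyMeasurable hc.measurableSet)).1 (hf.2 K hK hc)

theorem of_memLp (hf : DifferentiableOn ℂ f U)
    (hw : AEMeasurable (fun x => EReal.exp (-2 * φ x)) (volume.restrict U))
    (h : ∀ K ⊆ U, IsCompact K → MemLp f 2 (expWeightMeasure φ K)) :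
    IsMultiplierSection φ U f :=
  ⟨hf, fun K hK hc =>
    (weightedSqIntegral_lt_top_iff (hw.mono_measure (Measure.restrict_mono_set _ hK))
      ((hf.continuousOn.mono hK).aestronglyMeasurable hc.measurableSet)).2 (h K hK hc)⟩

theorem add (hw : AEMeasurable (fun x => EReal.exp (-2 * φ x)) (volume.restrict U))
    (hf : IsMultiplierSection φ U f) (hg : IsMultiplierSection φ U g) :
    IsMultiplierSection φ U (f + g) :=
  of_memLp (hf.1.add hg.1) hw fun _ hK hc => (hf.memLp hw hK hc).add (hg.memLp hw hK hc)

theorem sub (hw : AEMeasurable (fun x => EReal.exp (-2 * φ x)) (volume.restrict U))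
    (hf : IsMultiplierSection φ U f) (hg : IsMultiplierSection φ U g) :
    IsMultiplierSection φ U (f - g) :=
  of_memLp (hf.1.sub hg.1) hw fun _ hK hc => (hf.memLp hw hK hc).sub (hg.memLp hw hK hc)

theorem const_smul (hw : AEMeasurable (fun x => EReal.exp (-2 * φ x)) (volume.restrict U))
    (hf : IsMultiplierSection φ U f) (c : ℂ) : IsMultiplierSection φ U (c • f) :=
  of_memLp (hf.1.const_smul c) hw fun _ hK hc => (hf.memLp hw hK hc).const_smul c

theorem zero : IsMultiplierSection φ U 0 :=
  ⟨differentiableOn_const 0, fun K _ _ => by simp [weightedSqIntegral]⟩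

/-- The multiplier ideal sheaf is closed under locally uniform convergence, when its stalks are
generated by germs. -/
theorem of_tendstoUniformlyOn {N : ℕ} {G : Fin N → (Fin n → ℂ) → ℂ} (hU : IsOpen U)
    (hgen : ∀ p ∈ U, GeneratesStalk G φ p) {f : ℕ → (Fin n → ℂ) → ℂ}
    (hf : ∀ k, IsMultiplierSection φ U (f k))
    (hfg : ∀ p ∈ U, ∃ r > 0, ball p r ⊆ U ∧ TendstoUniformlyOn f g atTop (ball p r)) :
    IsMultiplierSection φ U g := by
  have hg : DifferentiableOn ℂ g U := by
    intro p hp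
    obtain ⟨r, hr, hrU, hconv⟩ := hfg p hp
    exact ((DifferentiableOn.of_tendstoUniformlyOn isOpen_ball (fun k => (hf k).1.mono hrU)
      hconv).differentiableAt (ball_mem_nhds p hr)).differentiableWithinAt
  refine ⟨hg, fun K hKU hK => ?_⟩
  refine hK.induction_on (p := fun S => weightedSqIntegral φ g S < ⊤)
    (by rw [weightedSqIntegral_empty]; exact ENNReal.zero_lt_top)
    (fun S T hST hT => (weightedSqIntegral_mono hST g).trans_lt hT)
    (fun S T hS hT => (weightedSqIntegral_union_le S T g).trans_lt
      (ENNReal.add_lt_top.2 ⟨hS, hT⟩)) fun p hpK => ?_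
  have hp := hKU hpK
  obtain ⟨r, hr, hrU, hconv⟩ := hfg p hp
  let S : Submodule (holGerms p) (Germ (𝓝 p) ℂ) :=
    Submodule.span (holGerms p) (Set.range fun i => (G i : Germ (𝓝 p) ℂ))
  have hS : ∀ x, x ∈ S ↔ x ∈ multiplierStalk φ p := fun x => by
    rw [← hgen p hp]; rfl
  -- The rings `holGerms p` and `holomorphicGerms p` agree definitionally, so the stalk becomes an
  -- ideal to which the closure theorem applies.
  let I : Ideal (holomorphicGerms p) :=
    Submodule.comap (Algebra.linearMap (holGerms p) (Germ (𝓝 p) ℂ)) S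
  have hmem := holomorphicGerms.mem_of_tendstoUniformlyOn I hr (fun k => (hf k).1.mono hrU)
    (hg.mono hrU) hconv fun k => (hS _).2 ⟨U, f k, hU, hp, hf k, rfl⟩
  obtain ⟨V, F, hV, hpV, hF, hFg⟩ := (hS _).1 hmem
  have hev : ∀ᶠ x in 𝓝 p, x ∈ V ∧ F x = g x := by
    filter_upwards [hV.mem_nhds hpV, Germ.coe_eq.1 hFg] with x h1 h2 using ⟨h1, h2⟩
  obtain ⟨s, hs, hsub⟩ := Metric.nhds_basis_closedBall.mem_iff.1 hev
  refine ⟨closedBall p s, mem_nhdsWithin_of_mem_nhds (closedBall_mem_nhds p hs), ?_⟩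
  rw [← weightedSqIntegral_congr isClosed_closedBall.measurableSet fun x hx => (hsub hx).2]
  exact hF.2 _ (fun x hx => (hsub hx).1) (isCompact_closedBall p s)

end IsMultiplierSection

/-- Extension of a function on `U` by zero. -/
noncomputable def zeroExtend (U : Set (Fin n → ℂ)) (F : U → ℂ) : (Fin n → ℂ) → ℂ :=
  Function.extend Subtype.val F 0

theorem zeroExtend_apply {U : Set (Fin n → ℂ)} (F : U → ℂ) (x : U) : zeroExtend U F x = F x :=
  Subtype.val_injective.extend_apply F 0 x

theorem zeroExtend_add {U : Set (Fin n → ℂ)} (F H : U → ℂ) :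
    zeroExtend U (F + H) = zeroExtend U F + zeroExtend U H := by
  have := Function.extend_add (Subtype.val : U → Fin n → ℂ) F H 0 0
  rwa [add_zero] at this

theorem zeroExtend_smul {U : Set (Fin n → ℂ)} (c : ℂ) (F : U → ℂ) :
    zeroExtend U (c • F) = c • zeroExtend U F := by
  have := Function.extend_smul c (Subtype.val : U → Fin n → ℂ) F 0
  rwa [smul_zero] at this

/-- The bounded sections of the multiplier ideal sheaf over `U`. -/
noncomputable def boundedSections (φ : (Fin n → ℂ) → EReal) (U : Set (Fin n → ℂ))
    (hw : AEMeasurable (fun x => EReal.exp (-2 * φ x)) (volume.restrict U)) :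
    Submodule ℂ (BoundedContinuousFunction U ℂ) where
  carrier := {F | IsMultiplierSection φ U (zeroExtend U F)}
  add_mem' {F H} hF hH := by
    have := IsMultiplierSection.add hw hF hH
    rwa [← zeroExtend_add] at this
  zero_mem' := by
    refine IsMultiplierSection.zero.congr fun x hx => ?_
    exact zeroExtend_apply _ (⟨x, hx⟩ : U)
  smul_mem' c F hF := by
    have := IsMultiplierSection.const_smul hw hF c
    rwa [← zeroExtend_smul] at this

theorem tendstoUniformlyOn_zeroExtend {U : Set (Fin n → ℂ)}
    {F : ℕ → BoundedContinuousFunction U ℂ} {H : BoundedContinuousFunction U ℂ}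
    (h : Tendsto F atTop (𝓝 H)) :
    TendstoUniformlyOn (fun k => zeroExtend U (F k)) (zeroExtend U H) atTop U := by
  have h1 := BoundedContinuousFunction.tendsto_iff_tendstoUniformly.1 h
  intro u hu
  filter_upwards [h1 u hu] with k hk x hx
  have h2 := hk ⟨x, hx⟩
  rwa [← zeroExtend_apply H ⟨x, hx⟩, ← zeroExtend_apply (F k) ⟨x, hx⟩] at h2

/-- This is Cartan's theorem in Banach space form: closedness in the sup-norm yields the
completeness that the Baire argument needs. -/
theorem isClosed_boundedSections {N : ℕ} {G : Fin N → (Fin n → ℂ) → ℂ} {U : Set (Fin n → ℂ)}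
    (hU : IsOpen U) (hgen : ∀ p ∈ U, GeneratesStalk G φ p)
    (hw : AEMeasurable (fun x => EReal.exp (-2 * φ x)) (volume.restrict U)) :
    IsClosed (boundedSections φ U hw : Set (BoundedContinuousFunction U ℂ)) := by
  refine IsSeqClosed.isClosed fun F H hF hlim => ?_
  refine IsMultiplierSection.of_tendstoUniformlyOn hU hgen (f := fun k => zeroExtend U (F k)) hF
    fun p hp => ?_
  obtain ⟨r, hr, hrU⟩ := Metric.isOpen_iff.1 hU p hp
  exact ⟨r, hr, hrU, (tendstoUniformlyOn_zeroExtend hlim).mono hrU⟩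

/-- The weighted `L²` seminorm over a compact subset on bounded sections. -/
noncomputable def weightedSeminorm (φ : (Fin n → ℂ) → EReal) {U : Set (Fin n → ℂ)}
    (hw : AEMeasurable (fun x => EReal.exp (-2 * φ x)) (volume.restrict U))
    {K : Set (Fin n → ℂ)} (hK : K ⊆ U) (hc : IsCompact K) :
    Seminorm ℂ (boundedSections φ U hw) :=
  Seminorm.of (fun F => (eLpNorm (zeroExtend U F.1) 2 (expWeightMeasure φ K)).toReal)
    (fun F H => by
      have hF := IsMultiplierSection.memLp F.2 hw hK hc
      have hH := IsMultiplierSection.memLp H.2 hw hK hc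
      rw [← ENNReal.toReal_add hF.2.ne hH.2.ne]
      refine ENNReal.toReal_mono (ENNReal.add_lt_top.2 ⟨hF.2, hH.2⟩).ne ?_
      have := eLpNorm_add_le hF.1 hH.1 one_le_two
      rwa [← zeroExtend_add] at this)
    (fun c F => by
      have : zeroExtend U (c • F).1 = c • zeroExtend U F.1 := zeroExtend_smul c F.1
      rw [this, eLpNorm_const_smul, ENNReal.toReal_mul, toReal_enorm])

/-- By Baire a Banach space is barrelled: closed sublevel sets of a finite seminorm are barrels,
hence neighbourhoods of 0. -/
theorem Seminorm.continuous_of_lowerSemicontinuous_of_complete {V : Type*}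
    [NormedAddCommGroup V] [NormedSpace ℂ V] [CompleteSpace V] (q : Seminorm ℂ V)
    (hq : LowerSemicontinuous q) : Continuous q :=
  q.continuous_of_lowerSemicontinuous hq

/-- Fatou's lemma closes the sublevel sets under uniform limits, giving lower semicontinuity;
completeness upgrades it to continuity. No dominating function is available, since `e^{-2φ}` need
not be integrable on `K`. -/
theorem continuous_weightedSeminorm {N : ℕ} {G : Fin N → (Fin n → ℂ) → ℂ} {U : Set (Fin n → ℂ)}
    (hU : IsOpen U) (hgen : ∀ p ∈ U, GeneratesStalk G φ p)
    (hw : AEMeasurable (fun x => EReal.exp (-2 * φ x)) (volume.restrict U))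
    {K : Set (Fin n → ℂ)} (hK : K ⊆ U) (hc : IsCompact K) :
    Continuous (weightedSeminorm φ hw hK hc) := by
  have : CompleteSpace (boundedSections φ U hw) :=
    (isClosed_boundedSections hU hgen hw).completeSpace_coe
  refine Seminorm.continuous_of_lowerSemicontinuous_of_complete _ ?_
  rw [lowerSemicontinuous_iff_isClosed_preimage]
  refine fun y => IsSeqClosed.isClosed fun F H hF hlim => ?_
  have hfin : ∀ F : boundedSections φ U hw, MemLp (zeroExtend U F.1) 2 (expWeightMeasure φ K) :=
    fun F => IsMultiplierSection.memLp F.2 hw hK hc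
  have hunif := tendstoUniformlyOn_zeroExtend
    ((continuous_subtype_val.tendsto H).comp hlim)
  have hle : ∀ k, eLpNorm (zeroExtend U (F k).1) 2 (expWeightMeasure φ K) ≤ ENNReal.ofReal y :=
    fun k => by
      rw [← ENNReal.ofReal_toReal (hfin (F k)).2.ne]
      exact ENNReal.ofReal_le_ofReal (hF k)
  have hy : 0 ≤ y := (ENNReal.toReal_nonneg).trans (hF 0)
  have hae : ∀ᵐ x ∂(expWeightMeasure φ K),
      Tendsto (fun k => zeroExtend U (F k).1 x) atTop (𝓝 (zeroExtend U H.1 x)) := by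
    refine (withDensity_absolutelyContinuous _ _).ae_le ?_
    filter_upwards [ae_restrict_mem hc.measurableSet] with x hx
    exact hunif.tendsto_at (hK hx)
  have := Lp.eLpNorm_le_of_ae_tendsto (Eventually.of_forall hle) (fun k => (hfin (F k)).1) hae
  exact ENNReal.toReal_le_of_le_ofReal hy this

/-- Bounded sections tending uniformly to 0 tend to 0 in the Banach space of bounded sections, where
the seminorm is continuous. -/
theorem tendsto_weightedSqIntegral_zero {N : ℕ} {G : Fin N → (Fin n → ℂ) → ℂ}
    {U : Set (Fin n → ℂ)} (hU : IsOpen U) (hgen : ∀ p ∈ U, GeneratesStalk G φ p)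
    (hw : AEMeasurable (fun x => EReal.exp (-2 * φ x)) (volume.restrict U))
    {h : ℕ → (Fin n → ℂ) → ℂ} (hh : ∀ k, IsMultiplierSection φ U (h k))
    (hb : ∀ k, ∃ C, ∀ x ∈ U, ‖h k x‖ ≤ C) (hlim : TendstoUniformlyOn h 0 atTop U)
    {K : Set (Fin n → ℂ)} (hK : K ⊆ U) (hc : IsCompact K) :
    Tendsto (fun k => weightedSqIntegral φ (h k) K) atTop (𝓝 0) := by
  choose C hC using hb
  let b : ℕ → BoundedContinuousFunction U ℂ := fun k =>
    BoundedContinuousFunction.ofNormedAddCommGroup (fun x : U => h k x)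
      (continuousOn_iff_continuous_domRestrict.1 (hh k).1.continuousOn) (C k) fun x => hC k x x.2
  have hbU : ∀ k, EqOn (zeroExtend U (b k)) (h k) U := fun k x hx =>
    zeroExtend_apply _ (⟨x, hx⟩ : U)
  let H : ℕ → boundedSections φ U hw := fun k => ⟨b k, (hh k).congr (hbU k)⟩
  have hH : Tendsto H atTop (𝓝 0) := by
    rw [tendsto_subtype_rng]
    refine BoundedContinuousFunction.tendsto_iff_tendstoUniformly.2 fun u hu => ?_
    filter_upwards [hlim u hu] with k hk x using hk x x.2
  have hp := ((continuous_weightedSeminorm hU hgen hw hK hc).tendsto 0).comp hH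
  rw [map_zero] at hp
  have hp2 := ENNReal.Tendsto.pow (n := 2) (ENNReal.tendsto_ofReal hp)
  rw [ENNReal.ofReal_zero, zero_pow two_ne_zero] at hp2
  refine hp2.congr fun k => ?_
  have hm := IsMultiplierSection.memLp (H k).2 hw hK hc
  have hco : ContinuousOn (zeroExtend U (b k)) K := (H k).2.1.continuousOn.mono hK
  rw [← weightedSqIntegral_congr hc.measurableSet ((hbU k).mono hK),
    weightedSqIntegral_eq_eLpNorm (hw.mono_measure (Measure.restrict_mono_set _ hK))
      (hco.aemeasurable hc.measurableSet)]
  change ENNReal.ofReal (eLpNorm (zeroExtend U (H k).1) 2 (expWeightMeasure φ K)).toReal ^ 2 = _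
  rw [ENNReal.ofReal_toReal hm.2.ne]

end MultiplierIdeal

/-! ### The main theorem. -/

theorem mainTheorem5 {n N : ℕ} (B : Set (Fin n → ℂ)) (hB : IsOpen B)
    (φ : (Fin n → ℂ) → EReal) (hφ : IsQuasiPsh φ B)
    (G : Fin N → (Fin n → ℂ) → ℂ) (hG : ∀ i, DifferentiableOn ℂ (G i) B)
    (hgen : ∀ p ∈ B, GeneratesStalk G φ p)
    (f : ℕ → (Fin n → ℂ) → ℂ) (hf : ∀ k, IsMultiplierSection φ B (f k))
    (flim : (Fin n → ℂ) → ℂ)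
    (hconv : ∀ K : Set (Fin n → ℂ), RelCompactIn K B → TendstoUniformlyOn f flim atTop K) :
    IsMultiplierSection φ B flim ∧
      ∀ K : Set (Fin n → ℂ), RelCompactIn K B →
        Tendsto (fun k => weightedSqIntegral φ (fun x => f k x - flim x) K) atTop (𝓝 0) := by
  have hcb : ∀ (p : Fin n → ℂ) (r : ℝ), Metric.closedBall p r ⊆ B →
      RelCompactIn (Metric.closedBall p r) B := fun p r h => by
    rw [RelCompactIn, Metric.isClosed_closedBall.closure_eq]
    exact ⟨isCompact_closedBall p r, h⟩
  have hlim : IsMultiplierSection φ B flim := by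
    refine IsMultiplierSection.of_tendstoUniformlyOn hB hgen hf fun p hp => ?_
    obtain ⟨r, hr, hrB⟩ := Metric.nhds_basis_closedBall.mem_iff.1 (hB.mem_nhds hp)
    exact ⟨r, hr, Metric.ball_subset_closedBall.trans hrB,
      (hconv _ (hcb p r hrB)).mono Metric.ball_subset_closedBall⟩
  refine ⟨hlim, fun K hK => ?_⟩
  suffices h : Tendsto (fun k => weightedSqIntegral φ (fun x => f k x - flim x) (closure K))
      atTop (𝓝 0) from
    tendsto_of_tendsto_of_tendsto_of_le_of_le tendsto_const_nhds h (fun _ => bot_le)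
      fun k => weightedSqIntegral_mono subset_closure _
  refine hK.1.induction_on
    (p := fun S => Tendsto (fun k => weightedSqIntegral φ (fun x => f k x - flim x) S) atTop (𝓝 0))
    (by simp only [weightedSqIntegral_empty]; exact tendsto_const_nhds)
    (fun S T hST hT => tendsto_of_tendsto_of_tendsto_of_le_of_le tendsto_const_nhds hT
      (fun _ => bot_le) fun k => weightedSqIntegral_mono hST _)
    (fun S T hS hT => ?_) fun p hp => ?_
  · have hST := hS.add hT
    rw [add_zero] at hST
    exact tendsto_of_tendsto_of_tendsto_of_le_of_le tendsto_const_nhds hST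
      (fun _ => bot_le) fun k => weightedSqIntegral_union_le S T _
  · obtain ⟨U, hU, hpU, hUB, hw⟩ := hφ.exists_aemeasurable_exp (hK.2 hp)
    obtain ⟨r, hr, hrU⟩ := Metric.nhds_basis_closedBall.mem_iff.1 (hU.mem_nhds hpU)
    have hbU : Metric.ball p r ⊆ U := Metric.ball_subset_closedBall.trans hrU
    have hwb := hw.mono_measure (Measure.restrict_mono_set volume hbU)
    have hsub : ∀ k, IsMultiplierSection φ (Metric.ball p r) (fun x => f k x - flim x) := fun k =>
      IsMultiplierSection.sub hwb ((hf k).mono (hbU.trans hUB)) (hlim.mono (hbU.trans hUB))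
    -- Two radii: the differences are bounded on the ball of radius `r` because its closure is a
    -- compact subset of `B`, while the integral runs over the compact ball of radius `r / 2` inside
    -- it.
    refine ⟨Metric.closedBall p (r / 2),
      mem_nhdsWithin_of_mem_nhds (Metric.closedBall_mem_nhds p (half_pos hr)),
      tendsto_weightedSqIntegral_zero Metric.isOpen_ball
        (fun q hq => hgen q (hUB (hbU hq))) hwb hsub (fun k => ?_) ?_
        (Metric.closedBall_subset_ball (half_lt_self hr)) (isCompact_closedBall p (r / 2))⟩
    · obtain ⟨C, hC⟩ := (isCompact_closedBall p r).exists_bound_of_continuousOn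
        (((hf k).1.sub hlim.1).continuousOn.mono (hrU.trans hUB))
      exact ⟨C, fun x hx => hC x (Metric.ball_subset_closedBall hx)⟩
    · have h1 := (hconv _ (hcb p r (hrU.trans hUB))).mono Metric.ball_subset_closedBall
      rw [Metric.tendstoUniformlyOn_iff] at h1 ⊢
      intro ε hε
      filter_upwards [h1 ε hε] with k hk x hx
      simpa [dist_eq_norm, norm_sub_rev] using hk x hx
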